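/- **Setting.** A source on $\mathbb Z$ evolves as $X_{t+1}=X_t+Z_t$, where the $Z_t$ are i.i.d. with a finitely supported law $\mu$ that is even and a.s.u. about $0$. Here $f:\mathbb Z\to\mathbb R$ is called *a.s.u. about $a$* (almost symmetric and unimodal) if $f(a+n)\ge f(a-n)\ge f(a+n+1)$ for all $n=0,1,2,\dots$. A sensor has energy levels $\mathcal E=\{0,1,\dots,B\}$. If it transmits at time $t$ ($U_t=1$, possible only if $E_t\ge 1$) it spends one unit of energy; put $E'_t=E_t-U_t$. The next level $E_{t+1}$ has, given $E'_t=e'$, a law $P_t(\cdot\mid e')$ on $\mathcal E$, independently of the source. The receiver gets $Y_t=(X_t,E_t)$ if $U_t=1$ and $Y_t=\epsilon$ (nothing) if $U_t=0$. A transmission costs $c$, and the estimate $\hat a$ of the state $x$ costs $\rho(x,\hat a)$, a non-decreasing function of $|x-\hat a|$. The horizon is $T$. A *belief* is a finitely supported probability distribution on $\mathbb Z\times\mathcal E$. A *prescription* is a function $\gamma:\mathbb Z\times\mathcal E\to[0,1]$ with $\gamma(x,0)=0$ for all $x$; $\gamma(x,e)$ is the probability of transmitting in state $(x,e)$. For a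 pre-transmission belief $\pi$ and a prescription $\gamma$ the post-transmission belief is $\Theta=\delta_{(x,e-1)}$ if $Y=(x,e)$, and $\Theta=\theta^\gamma$ with $\theta^\gamma(x,e)=\pi(x,e)(1-\gamma(x,e))\big/\sum_{x',e'}\pi(x',e')(1-\gamma(x',e'))$ if $Y=\epsilon$. For a post-transmission belief $\theta$ put $Q_{t+1}(\theta)(x,e)=\sum_{x',e'}\mu(x-x')P_t(e\mid e')\theta(x',e')$. Define the value functions by $W_{T+1}:=0$ and, for $t=T,\dots,1$, $$V_t(\theta)=W_{t+1}(Q_{t+1}(\theta))+\min_{\hat a\in\mathbb Z}\sum_{x,e}\rho(x,\hat a)\,\theta(x,e),$$ $$W_t(\pi)=\min_{\gamma}\mathbb W_t(\pi,\gamma),\qquad \mathbb W_t(\pi,\gamma)=\sum_{x,e}\pi(x,e)\Big[\gamma(x,e)\big(c+V_t(\delta_{(x,e-1)})\big)+(1-\gamma(x,e))V_t(\theta^\gamma)\Big],$$ the minimum being over all prescriptions $\gamma$. **Lemma.** Let $1\le t\le T$, and let $\pi$ be a belief such that, for one point $a\in\mathbb Z$, $\pi(\cdot,e)$ is a.s.u.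 about $a$ for every $e\in\mathcal E$. Then the minimum defining $W_t(\pi)$ is achieved by a prescription $\gamma$ of threshold form about $a$: let $s(0),s(1),s(2),\dots$ be the sequence $0,1,-1,2,-2,3,-3,\dots$; for every energy level $e\ge 1$ there are an integer $n(e)\ge 0$ and a number $p(e)\in[0,1]$ with $$\gamma(a+s(k),e)=\begin{cases}0,&k<n(e),\\ p(e),&k=n(e),\\ 1,&k>n(e).\end{cases}$$ (At $e=0$ no transmission is possible, so $\gamma(\cdot,0)=0$.) -/

import Mathlib

noncomputable section

/-- `f` is almost symmetric and unimodal about `a`: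
`f a ≥ f (a+1) ≥ f (a-1) ≥ f (a+2) ≥ f (a-2) ≥ ⋯`. -/
def IsASU (f : ℤ → ℝ) (a : ℤ) : Prop :=
  ∀ n : ℕ, f (a - n) ≤ f (a + n) ∧ f (a + n + 1) ≤ f (a - n)

/-- The enumeration `0, 1, -1, 2, -2, 3, -3, …` of the integers, indexed from `0`. -/
def centreOrder (k : ℕ) : ℤ :=
  if k % 2 = 0 then -((k / 2 : ℕ) : ℤ) else ((k / 2 : ℕ) : ℤ) + 1

/-- `g : ℤ → ℝ` (transmission probabilities at one fixed energy level) is of threshold form about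
`a`: in the order `a, a+1, a-1, a+2, …` it is `0` before the `n`-th state, some `p ∈ [0,1]` at the
`n`-th state, and `1` at all later states. -/
def IsThreshold (g : ℤ → ℝ) (a : ℤ) : Prop :=
  ∃ (n : ℕ) (p : ℝ), 0 ≤ p ∧ p ≤ 1 ∧ ∀ k : ℕ,
    (k < n → g (a + centreOrder k) = 0) ∧
    (k = n → g (a + centreOrder k) = p) ∧
    (n < k → g (a + centreOrder k) = 1)

/-- The data of the remote estimation problem with an energy harvesting sensor.
The source is `X_{t+1} = X_t + Z_t` with i.i.d. finitely supported noise whose law is even and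
almost symmetric and unimodal. The energy levels are `0, …, B`. -/
structure RemoteEstimation where
  /-- time horizon -/
  T : ℕ
  /-- battery capacity -/
  B : ℕ
  /-- law of the source increments `Z_t` -/
  noise : ℤ →₀ ℝ
  noise_nonneg : ∀ z, 0 ≤ noise z
  noise_sum : (noise.sum fun _ q => q) = 1
  noise_asu : IsASU noise 0
  noise_even : ∀ z, noise (-z) = noise z
  /-- `harvest t e' e` is the probability that `E_{t+1} = e` given that the energy level after the
  transmission decision at time `t` is `E'_t = e'` (for instance `E_{t+1} = min (E'_t + N_t) B` with
  independent harvested amounts `N_t`) -/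
  harvest : ℕ → Fin (B + 1) → Fin (B + 1) → ℝ
  harvest_nonneg : ∀ t e' e, 0 ≤ harvest t e' e
  harvest_sum : ∀ t e', ∑ e, harvest t e' e = 1
  /-- cost of one transmission -/
  c : ℝ
  /-- `d i` is the distortion at distance `i` between state and estimate -/
  d : ℕ → ℝ
  d_mono : Monotone d

namespace RemoteEstimation

variable (M : RemoteEstimation)

/-- A pair (source state, energy level). -/
abbrev State : Type := ℤ × Fin (M.B + 1)

/-- Finitely supported real weights on pairs (source state, energy level). -/
abbrev Weight : Type := M.State →₀ ℝ

variable {M} in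
/-- A belief: a probability distribution with finite support. -/
def IsBelief (θ : M.Weight) : Prop :=
  (∀ s, 0 ≤ θ s) ∧ (θ.sum fun _ p => p) = 1

variable {M} in
/-- A prescription gives for each state and energy level the probability of transmitting; without
energy no transmission is possible. -/
def IsPrescription (γ : M.State → ℝ) : Prop :=
  (∀ s, 0 ≤ γ s ∧ γ s ≤ 1) ∧ ∀ x, γ (x, 0) = 0

/-- The distortion function `ρ(x, a)`. -/
def dist (x a : ℤ) : ℝ := M.d (x - a).natAbs

/-- The energy level after spending one unit. -/
def spend (e : Fin (M.B + 1)) : Fin (M.B + 1) :=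
  ⟨(e : ℕ) - 1, lt_of_le_of_lt (Nat.sub_le _ _) e.isLt⟩

/-- The probability of the event "no transmission" under the belief `π` and the prescription
`γ`. -/
def silenceProb (π : M.Weight) (γ : M.State → ℝ) : ℝ :=
  π.sum fun s p => p * (1 - γ s)

/-- The post-transmission belief (law of `(X_t, E'_t)`) obtained by Bayes' rule from the
pre-transmission belief `π` (law of `(X_t, E_t)`), the prescription `γ` and the received symbol:
`some (x, e)` if the sensor transmitted in state `(x, e)`, and `none` if it was silent. -/
def update (π : M.Weight) (γ : M.State → ℝ) : Option M.State → M.Weight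
  | some (x, e) => Finsupp.single (x, M.spend e) 1
  | none => Finsupp.onFinset π.support (fun s => π s * (1 - γ s) / M.silenceProb π γ) (by
      intro s hs
      rw [Finsupp.mem_support_iff]
      intro h
      exact hs (by simp [h]))

/-- The law of `(X_{t+1}, E_{t+1})` when `(X_t, E'_t)` has law `θ`. -/
def predict (t : ℕ) (θ : M.Weight) : M.Weight :=
  θ.sum fun s p => M.noise.sum fun z q =>
    ∑ e, Finsupp.single (s.1 + z, e) (q * M.harvest t s.2 e * p)

theorem predict_apply (t : ℕ) (θ : M.Weight) (x : ℤ) (e : Fin (M.B + 1)) :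
    M.predict t θ (x, e) = θ.sum fun s p => M.noise (x - s.1) * M.harvest t s.2 e * p := by
  classical
  unfold predict
  rw [Finsupp.sum_apply]
  refine Finsupp.sum_congr fun s _ => ?_
  rw [Finsupp.sum_apply]
  simp only [Finsupp.finsetSum_apply, Finsupp.single_apply, Prod.mk.injEq]
  rw [Finsupp.sum, Finset.sum_eq_single (x - s.1)]
  · rw [Finset.sum_eq_single e]
    · simp
    · intro e' _ he'
      simp [he']
    · simp
  · intro z _ hz
    refine Finset.sum_eq_zero fun e' _ => if_neg fun h => hz ?_
    have := h.1
    omega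
  · intro hz
    rw [Finsupp.notMem_support_iff] at hz
    simp [hz]

/-- The expectation of `c · 1{U_t = 1} + v(Θ_t)`, where `(X_t, E_t)` has law `π`, the sensor
transmits (`U_t = 1`) with conditional probability `γ (X_t, E_t)`, and `Θ_t` is the resulting
post-transmission belief. -/
def cost (v : M.Weight → ℝ) (π : M.Weight) (γ : M.State → ℝ) : ℝ :=
  π.sum fun s p =>
    p * (γ s * (M.c + v (M.update π γ (some s))) + (1 - γ s) * v (M.update π γ none))

/-- The smallest expected distortion under the post-transmission belief `θ`. -/
def minDistortion (θ : M.Weight) : ℝ :=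
  ⨅ a : ℤ, θ.sum fun s p => p * M.dist s.1 a

/-- The pre-transmission value function with `k` time steps to go. -/
def valueToGo : ℕ → M.Weight → ℝ
  | 0 => fun _ => 0
  | k + 1 => fun π => ⨅ γ : {γ : M.State → ℝ // IsPrescription γ},
      M.cost (fun θ => M.minDistortion θ + valueToGo k (M.predict (M.T - k) θ)) π γ

/-- The value function `W_t` before the transmission decision at time `t`. -/
def W (t : ℕ) (π : M.Weight) : ℝ := M.valueToGo (M.T + 1 - t) π

/-- The value function `V_t` after the transmission decision at time `t`. -/
def V (t : ℕ) (θ : M.Weight) : ℝ := M.minDistortion θ + M.W (t + 1) (M.predict t θ)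

/-- Terminal condition of the dynamic program. -/
theorem W_terminal (π : M.Weight) : M.W (M.T + 1) π = 0 := by
  simp [W, valueToGo]

/-- Recursion of the dynamic program. -/
theorem W_eq {t : ℕ} (ht : t ≤ M.T) (π : M.Weight) :
    M.W t π = ⨅ γ : {γ : M.State → ℝ // IsPrescription γ}, M.cost (M.V t) π γ := by
  obtain ⟨k, hk⟩ := Nat.exists_eq_add_of_le ht
  have h1 : M.T + 1 - t = k + 1 := by omega
  have h2 : M.T - k = t := by omega
  have h3 : M.T + 1 - (t + 1) = k := by omega
  unfold W V
  simp only [W, h1, h3, valueToGo, h2]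

end RemoteEstimation

end

/-! Extend the value functions from beliefs to all nonnegative finitely supported weights. By
induction over the horizon they are positively homogeneous, superadditive, bounded below by a
multiple of the mass, and monotone: concentrating every energy slice about `a`, in the sense of
`CentreMajorizes`, does not increase the value (`IsRegular`).

Homogeneity cancels Bayes' normalization, so a prescription costs a linear transmission term plus
the value of the unnormalized silent part. Monotonicity, applied both ways to point masses, shows
that the price of transmitting does not depend on the position. Hence, level by level, only the
silent mass and its shape matter. Keeping the same silent mass but filling it from the centre
outwards gives a threshold prescription whose silent part majorizes the original one, so it costs no
more (`IsRegular.exists_threshold_cost_le`). This exchange also carries monotonicity through the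
Bellman minimum.

Two further steps must respect majorization. The noise is a mixture of uniform laws on symmetric
windows, so prediction reduces to a discrete Riesz rearrangement inequality, which comes from
counting close pairs of integers (`CentreMajorizes.windowSum`). Distortion is handled by a
Hardy–Littlewood inequality (`CentreMajorizes.sum_distortion_le`). Finally, homogeneity and
superadditivity make the cost concave in the prescription, so a minimizer exists among finitely many
deterministic ones, and the exchange turns it into a threshold. -/

/-- The enumeration `centreOrder` as a bijection between `ℕ` and `ℤ`. -/
def centreEquiv : ℕ ≃ ℤ where
  toFun := centreOrder
  invFun z := if z ≤ 0 then 2 * z.natAbs else 2 * z.natAbs - 1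
  left_inv k := by
    unfold centreOrder
    rcases Nat.even_or_odd' k with ⟨m, rfl | rfl⟩ <;> dsimp only <;> split_ifs <;> omega
  right_inv z := by
    unfold centreOrder
    dsimp only
    split_ifs <;> omega

theorem centreOrder_even (n : ℕ) : centreOrder (2 * n) = -n := by
  unfold centreOrder
  split_ifs <;> omega

theorem centreOrder_odd (n : ℕ) : centreOrder (2 * n + 1) = n + 1 := by
  unfold centreOrder
  split_ifs <;> omega

theorem natAbs_centreOrder (k : ℕ) : (centreOrder k).natAbs = (k + 1) / 2 := by
  unfold centreOrder
  split_ifs <;> omega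

/-- The bijection `k ↦ a + centreOrder k`. -/
def centreEquivAt (a : ℤ) : ℕ ≃ ℤ := centreEquiv.trans (Equiv.addLeft a)

@[simp] theorem centreEquivAt_apply (a : ℤ) (k : ℕ) :
    centreEquivAt a k = a + centreOrder k := rfl

theorem centreOrder_injective (a : ℤ) : Function.Injective fun k => a + centreOrder k :=
  (centreEquivAt a).injective

theorem isASU_iff_antitone {f : ℤ → ℝ} {a : ℤ} :
    IsASU f a ↔ Antitone fun k => f (a + centreOrder k) := by
  constructor
  · intro h
    refine antitone_nat_of_succ_le fun k => ?_
    change f _ ≤ f _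
    rcases Nat.even_or_odd' k with ⟨m, rfl | rfl⟩
    · have := (h m).2
      rw [centreOrder_even, centreOrder_odd]
      convert this using 2 <;> ring
    · have := (h (m + 1)).1
      rw [show 2 * m + 1 + 1 = 2 * (m + 1) by ring, centreOrder_even, centreOrder_odd]
      convert this using 2 <;> push_cast <;> ring
  · intro h n
    constructor
    · rcases n with _ | n
      · simp
      · have := h (Nat.le_succ (2 * n + 1))
        change f _ ≤ f _ at this
        rw [Nat.succ_eq_add_one] at this
        rw [show 2 * n + 1 + 1 = 2 * (n + 1) by ring, centreOrder_even, centreOrder_odd] at this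
        convert this using 2 <;> push_cast <;> ring
    · have := h (Nat.le_succ (2 * n))
      change f _ ≤ f _ at this
      rw [Nat.succ_eq_add_one] at this
      rw [centreOrder_even, centreOrder_odd] at this
      convert this using 2 <;> ring

/-! ### Rearrangement inequalities for finite sums -/

theorem sum_le_sum_range_card {x : ℕ → ℝ} (hx : Antitone x) (K : Finset ℕ) :
    ∑ k ∈ K, x k ≤ ∑ k ∈ Finset.range K.card, x k := by
  induction K using Finset.induction_on_max with
  | empty => simp
  | insert m K hm ih =>
    have hmem : m ∉ K := fun h => lt_irrefl _ (hm m h)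
    have hcard : K.card ≤ m := by
      have : K ⊆ Finset.range m := fun k hk => Finset.mem_range.2 (hm k hk)
      simpa using Finset.card_le_card this
    rw [Finset.sum_insert hmem, Finset.card_insert_of_notMem hmem, Finset.sum_range_succ, add_comm]
    exact add_le_add ih (hx hcard)

/-- Abel summation: nonincreasing nonnegative weights preserve an inequality between all partial
sums. -/
theorem sum_mul_le_sum_mul_of_partial_sums_le {x p q : ℕ → ℝ} {n : ℕ}
    (hx : ∀ i, i + 1 < n → x (i + 1) ≤ x i) (hx0 : ∀ i < n, 0 ≤ x i)
    (h : ∀ i ≤ n, ∑ j ∈ Finset.range i, p j ≤ ∑ j ∈ Finset.range i, q j) :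
    ∑ j ∈ Finset.range n, x j * p j ≤ ∑ j ∈ Finset.range n, x j * q j := by
  rcases n with _ | n
  · simp
  have key : ∀ i ≤ n, x i * (∑ j ∈ Finset.range (i + 1), (q j - p j)) ≤
      ∑ j ∈ Finset.range (i + 1), x j * (q j - p j) := by
    intro i
    induction i with
    | zero => simp
    | succ i ih =>
      intro hi
      have h1 := ih (by omega)
      have h2 := h (i + 1) (by omega)
      have h3 : 0 ≤ ∑ j ∈ Finset.range (i + 1), (q j - p j) := by
        rw [Finset.sum_sub_distrib]; linarith
      have h4 := mul_le_mul_of_nonneg_right (hx i (by omega)) h3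
      rw [Finset.sum_range_succ, Finset.sum_range_succ _ (i + 1), mul_add]
      linarith
  have h1 := key n le_rfl
  have h2 : 0 ≤ x n * (∑ j ∈ Finset.range (n + 1), (q j - p j)) := by
    refine mul_nonneg (hx0 n (by omega)) ?_
    rw [Finset.sum_sub_distrib]
    linarith [h (n + 1) le_rfl]
  have h3 : ∑ j ∈ Finset.range (n + 1), x j * (q j - p j) =
      ∑ j ∈ Finset.range (n + 1), x j * q j - ∑ j ∈ Finset.range (n + 1), x j * p j := by
    rw [← Finset.sum_sub_distrib]
    exact Finset.sum_congr rfl fun _ _ => by ring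
  linarith

theorem exists_sorted_enumeration {α : Type*} [DecidableEq α] [Inhabited α] (D : Finset α)
    (f : α → ℝ) :
    ∃ y : ℕ → α, Set.InjOn y (Finset.range D.card : Set ℕ) ∧ (Finset.range D.card).image y = D ∧
      ∀ i, i + 1 < D.card → f (y (i + 1)) ≤ f (y i) := by
  induction hn : D.card generalizing D with
  | zero =>
    rw [Finset.card_eq_zero] at hn
    exact ⟨fun _ => default, by simp, by simp [hn], by simp⟩
  | succ n ih =>
    obtain ⟨x, hx, hmin⟩ := Finset.exists_min_image D f (Finset.card_pos.1 (by omega))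
    obtain ⟨y, hinj, him, hanti⟩ := ih (D.erase x) (by rw [Finset.card_erase_of_mem hx]; omega)
    have hy : ∀ i < n, y i ∈ D.erase x := fun i hi => by
      rw [← him]; exact Finset.mem_image_of_mem _ (Finset.mem_range.2 hi)
    have himage : (Finset.range (n + 1)).image (fun i => if i = n then x else y i) = D := by
      rw [Finset.range_add_one, Finset.image_insert, if_pos rfl, ← Finset.insert_erase hx, ← him]
      congr 1
      rw [him, ← him]
      refine Finset.image_congr fun i hi => if_neg ?_
      have := Finset.mem_range.1 hi
      omega
    refine ⟨fun i => if i = n then x else y i, ?_, himage, ?_⟩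
    · rw [← Finset.card_image_iff, himage, hn, Finset.card_range]
    · intro i hi
      have h1 : i ≠ n := by omega
      simp only [if_neg h1]
      split_ifs with h
      · exact hmin _ (Finset.mem_of_mem_erase (hy i (by omega)))
      · exact hanti i (by omega)

/-- A Hardy–Littlewood inequality. Enumerate `D` with `f'` decreasing; Abel summation replaces `w'`
by `w` with weights `f'`, then `f'` by `f` with weights `w`. -/
theorem sum_mul_le_of_dominated {α : Type*} [DecidableEq α] [Inhabited α] {D : Finset α}
    {f' w' : α → ℝ}
    {f w : ℕ → ℝ} (hf'0 : ∀ x ∈ D, 0 ≤ f' x)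
    (hf' : ∀ D' ⊆ D, ∑ x ∈ D', f' x ≤ ∑ k ∈ Finset.range D'.card, f k)
    (hw' : ∀ D' ⊆ D, ∑ x ∈ D', w' x ≤ ∑ k ∈ Finset.range D'.card, w k)
    (hw : Antitone w) (hw0 : ∀ k < D.card, 0 ≤ w k) :
    ∑ x ∈ D, f' x * w' x ≤ ∑ k ∈ Finset.range D.card, f k * w k := by
  obtain ⟨y, hinj, him, hanti⟩ := exists_sorted_enumeration D f'
  have hinj' : ∀ i ≤ D.card, Set.InjOn y (Finset.range i : Set ℕ) := fun i hi =>
    hinj.mono (by simpa using Set.Iio_subset_Iio hi)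
  have hsub : ∀ i ≤ D.card, (Finset.range i).image y ⊆ D := fun i hi => by
    conv_rhs => rw [← him]
    exact Finset.image_subset_image (Finset.range_subset_range.2 hi)
  have hpart : ∀ (g : α → ℝ) (b : ℕ → ℝ),
      (∀ D' ⊆ D, ∑ x ∈ D', g x ≤ ∑ k ∈ Finset.range D'.card, b k) → ∀ i ≤ D.card,
      ∑ j ∈ Finset.range i, g (y j) ≤ ∑ j ∈ Finset.range i, b j := by
    intro g b h i hi
    have := h _ (hsub i hi)
    rwa [Finset.sum_image (hinj' i hi), Finset.card_image_of_injOn (hinj' i hi),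
      Finset.card_range] at this
  calc ∑ x ∈ D, f' x * w' x = ∑ j ∈ Finset.range D.card, f' (y j) * w' (y j) := by
        conv_lhs => rw [← him]
        rw [Finset.sum_image hinj]
    _ ≤ ∑ j ∈ Finset.range D.card, f' (y j) * w j := by
        refine sum_mul_le_sum_mul_of_partial_sums_le hanti (fun i hi => hf'0 _ ?_)
          (hpart w' w hw')
        exact hsub _ le_rfl (Finset.mem_image_of_mem _ (Finset.mem_range.2 hi))
    _ = ∑ j ∈ Finset.range D.card, w j * f' (y j) := by simp_rw [mul_comm]
    _ ≤ ∑ j ∈ Finset.range D.card, w j * f j :=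
        sum_mul_le_sum_mul_of_partial_sums_le (fun i _ => hw (Nat.le_succ i)) hw0 (hpart f' f hf')
    _ = ∑ j ∈ Finset.range D.card, f j * w j := by simp_rw [mul_comm]

/-! ### Riesz rearrangement for indicator functions -/

/-- The number of pairs in `A × D` at distance at most `r`. -/
def closePairs (r : ℕ) (A D : Finset ℤ) : ℕ :=
  ((A ×ˢ D).filter fun s => (s.1 - s.2).natAbs ≤ r).card

/-- The largest number of pairs at distance at most `r` between a `p`-set and a `q`-set of
integers, computed from a decomposition of the `p × q` grid into nested hooks. -/
def hookSum (r : ℕ) : ℕ → ℕ → ℕ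
  | 0, _ => 0
  | _ + 1, 0 => 0
  | p + 1, q + 1 => min (p + q + 1) (2 * r + 1) + hookSum r p q

/-- Strip the minimum from both sets. The pairs that contain a minimum form a hook of `p + q + 1`
points on which the difference of coordinates is injective, so at most `2 * r + 1` of them are
close. -/
theorem closePairs_le_hookSum (r : ℕ) (A D : Finset ℤ) :
    closePairs r A D ≤ hookSum r A.card D.card := by
  induction hp : A.card generalizing A D with
  | zero =>
    rw [Finset.card_eq_zero] at hp
    simp [closePairs, hp]
  | succ p ih =>
    rcases hq : D.card with _ | q
    · rw [Finset.card_eq_zero] at hq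
      simp [closePairs, hq]
    have hA : A.Nonempty := Finset.card_pos.1 (by omega)
    have hD : D.Nonempty := Finset.card_pos.1 (by omega)
    set α := A.min' hA with hα
    set β := D.min' hD with hβ
    have hαA : α ∈ A := A.min'_mem hA
    have hβD : β ∈ D := D.min'_mem hD
    have hαle : ∀ x ∈ A, α ≤ x := fun x hx => A.min'_le x hx
    have hβle : ∀ x ∈ D, β ≤ x := fun x hx => D.min'_le x hx
    have hcA : (A.erase α).card = p := by rw [Finset.card_erase_of_mem hαA]; omega
    have hcD : (D.erase β).card = q := by rw [Finset.card_erase_of_mem hβD]; omega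
    have hrec := ih (A.erase α) (D.erase β) hcA
    rw [hcD] at hrec
    set H := (A ×ˢ D).filter fun s => (s.1 - s.2).natAbs ≤ r ∧ (s.1 = α ∨ s.2 = β) with hH
    have hsub : ((A ×ˢ D).filter fun s => (s.1 - s.2).natAbs ≤ r) ⊆
        H ∪ ((A.erase α ×ˢ D.erase β).filter fun s => (s.1 - s.2).natAbs ≤ r) := by
      intro s hs
      simp only [hH, Finset.mem_union, Finset.mem_filter, Finset.mem_product,
        Finset.mem_erase] at hs ⊢
      tauto
    have h1 : H.card ≤ p + q + 1 := by
      have hsub2 : H ⊆ ({α} ×ˢ D) ∪ (A.erase α ×ˢ {β}) := by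
        intro s hs
        simp only [hH, Finset.mem_union, Finset.mem_filter, Finset.mem_product,
          Finset.mem_erase, Finset.mem_singleton] at hs ⊢
        tauto
      refine (Finset.card_le_card hsub2).trans ((Finset.card_union_le _ _).trans ?_)
      rw [Finset.card_product, Finset.card_product, hcA, hq]
      simp only [Finset.card_singleton]
      omega
    have h2 : H.card ≤ 2 * r + 1 := by
      have hcard : (Finset.Icc (-(r : ℤ)) r).card = 2 * r + 1 := by
        rw [Int.card_Icc]; omega
      rw [← hcard]
      refine Finset.card_le_card_of_injOn (fun s => s.1 - s.2) ?_ ?_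
      · intro s hs
        simp only [hH, Finset.coe_filter, Set.mem_ofPred_eq, Finset.mem_product] at hs
        simp only [Finset.coe_Icc, Set.mem_Icc]
        omega
      · intro s hs s' hs' heq
        simp only [hH, Finset.coe_filter, Set.mem_ofPred_eq, Finset.mem_product] at hs hs' heq
        have e1 := hαle _ hs.1.1
        have e2 := hβle _ hs.1.2
        have e3 := hαle _ hs'.1.1
        have e4 := hβle _ hs'.1.2
        ext <;> omega
    calc closePairs r A D ≤ H.card + closePairs r (A.erase α) (D.erase β) :=
          (Finset.card_le_card hsub).trans (Finset.card_union_le _ _)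
      _ ≤ hookSum r (p + 1) (q + 1) := by
          rw [hookSum]
          exact add_le_add (le_min h1 h2) hrec

/-- The hypotheses say that the intervals are concentric up to half a unit, and this survives
removal of both left endpoints. The differences along the hook then form an interval centred up to
half a unit, so the hook bound is attained. -/
theorem hookSum_le_closePairs_Ico (r p q : ℕ) (α β : ℤ)
    (h1 : 2 * α + p ≤ 2 * β + q + 1) (h2 : 2 * β + q ≤ 2 * α + p + 1) :
    hookSum r p q ≤ closePairs r (Finset.Ico α (α + p)) (Finset.Ico β (β + q)) := by
  induction p generalizing q α β with
  | zero => simp [hookSum]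
  | succ p ih =>
    rcases q with _ | q
    · simp [hookSum]
    have hrec := ih q (α + 1) (β + 1) (by push_cast at *; omega) (by push_cast at *; omega)
    rw [hookSum]
    -- `Z` holds the differences of size at most `r` that occur on the hook; `φ` returns the hook
    -- point with a given difference.
    set Z := Finset.Icc (max (-(r : ℤ)) (α - β - q)) (min (r : ℤ) (α - β + p)) with hZ
    set φ : ℤ → ℤ × ℤ := fun z => if z ≤ α - β then (α, α - z) else (β + z, β) with hφ
    have hφinj : Set.InjOn φ Z := by
      intro z _ z' _ h
      simp only [hφ] at h
      split_ifs at h <;> simp only [Prod.mk.injEq] at h <;> omega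
    have hcardZ : min (p + q + 1) (2 * r + 1) ≤ Z.card := by
      rw [hZ, Int.card_Icc]
      push_cast at *
      omega
    have hdisj : Disjoint (Z.image φ) ((Finset.Ico (α + 1) (α + 1 + p) ×ˢ
        Finset.Ico (β + 1) (β + 1 + q)).filter fun s => (s.1 - s.2).natAbs ≤ r) := by
      rw [Finset.disjoint_left]
      intro s hs hs'
      obtain ⟨z, _, rfl⟩ := Finset.mem_image.1 hs
      simp only [hφ, Finset.mem_filter, Finset.mem_product, Finset.mem_Ico] at hs'
      split_ifs at hs' <;> simp only at hs' <;> omega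
    calc min (p + q + 1) (2 * r + 1) + hookSum r p q
        ≤ Z.card + closePairs r (Finset.Ico (α + 1) (α + 1 + p))
            (Finset.Ico (β + 1) (β + 1 + q)) := add_le_add hcardZ hrec
      _ ≤ closePairs r (Finset.Ico α (α + (p + 1 : ℕ))) (Finset.Ico β (β + (q + 1 : ℕ))) := by
        rw [← Finset.card_image_of_injOn hφinj, closePairs, ← Finset.card_union_of_disjoint hdisj]
        refine Finset.card_le_card fun s hs => ?_
        rcases Finset.mem_union.1 hs with hs | hs
        · obtain ⟨z, hz, rfl⟩ := Finset.mem_image.1 hs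
          simp only [hZ, Finset.mem_Icc] at hz
          simp only [hφ, Finset.mem_filter, Finset.mem_product, Finset.mem_Ico]
          split_ifs <;> simp only <;> push_cast <;> omega
        · simp only [Finset.mem_filter, Finset.mem_product, Finset.mem_Ico] at hs ⊢
          push_cast
          omega

theorem image_centreOrder_range (p : ℕ) :
    (Finset.range p).image centreOrder =
      Finset.Ico (-(((p - 1) / 2 : ℕ) : ℤ)) (-(((p - 1) / 2 : ℕ) : ℤ) + p) := by
  refine Finset.eq_of_subset_of_card_le ?_ ?_
  · intro z hz
    obtain ⟨k, hk, rfl⟩ := Finset.mem_image.1 hz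
    rw [Finset.mem_range] at hk
    rw [Finset.mem_Ico]
    unfold centreOrder
    split_ifs <;> omega
  · rw [Finset.card_image_of_injective _ (show Function.Injective centreOrder from centreEquiv.injective), Finset.card_range, Int.card_Ico]
    omega

theorem closePairs_le_closePairs_centreOrder (r : ℕ) (A D : Finset ℤ) :
    closePairs r A D ≤ closePairs r ((Finset.range A.card).image centreOrder)
      ((Finset.range D.card).image centreOrder) := by
  -- A segment of `p ≥ 1` points starting at `α` has `2α + p` equal to 1 or 2, so any two are nearly
  -- concentric. For `p = 0` the value is 0, hence the separate treatment of empty sets.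
  rcases Nat.eq_zero_or_pos A.card with h | hA
  · rw [Finset.card_eq_zero] at h
    simp [closePairs, h]
  rcases Nat.eq_zero_or_pos D.card with h | hD
  · rw [Finset.card_eq_zero] at h
    simp [closePairs, h]
  rw [image_centreOrder_range, image_centreOrder_range]
  exact (closePairs_le_hookSum r A D).trans
    (hookSum_le_closePairs_Ico r _ _ _ _ (by omega) (by omega))

/-! ### Window sums preserve almost symmetric unimodality -/

/-- Reflection about `c / 2` maps the part of the window on the negative axis into the rest of the
window, where it is compensated; the window stays long enough because its centre `n` is nonnegative.
-/
theorem sum_Icc_nonneg_of_antisymmetric {h : ℤ → ℝ} {c : ℤ} (hc0 : c ≤ 0) (hc : -1 ≤ c)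
    (hodd : ∀ z, h (c - z) = -h z) (hpos : ∀ z, 0 ≤ z → 0 ≤ h z) (n r : ℕ) :
    0 ≤ ∑ z ∈ Finset.Icc (-(r : ℤ)) r, h (n + z) := by
  set I := Finset.Icc (-(r : ℤ)) r with hI
  set J := I.filter fun z => (n : ℤ) + z < 0 with hJ
  have hinj : Function.Injective fun z : ℤ => c - 2 * n - z := fun x y hxy => by
    simp only at hxy; omega
  have hsub : J.image (fun z => c - 2 * n - z) ⊆ I.filter fun z => ¬ (n : ℤ) + z < 0 := by
    intro y hy
    obtain ⟨z, hz, rfl⟩ := Finset.mem_image.1 hy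
    simp only [hJ, hI, Finset.mem_filter, Finset.mem_Icc] at hz ⊢
    omega
  rw [← Finset.sum_filter_add_sum_filter_not I fun z => (n : ℤ) + z < 0]
  have h1 : ∑ z ∈ J.image (fun z => c - 2 * n - z), h (n + z) ≤
      ∑ z ∈ I.filter (fun z => ¬ (n : ℤ) + z < 0), h (n + z) := by
    refine Finset.sum_le_sum_of_subset_of_nonneg hsub fun z hz _ => hpos _ ?_
    have := (Finset.mem_filter.1 hz).2
    omega
  rw [Finset.sum_image hinj.injOn] at h1
  have h2 : ∑ z ∈ J, h (n + (c - 2 * n - z)) = -∑ z ∈ J, h (n + z) := by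
    rw [← Finset.sum_neg_distrib]
    refine Finset.sum_congr rfl fun z _ => ?_
    rw [← hodd]
    congr 1
    ring
  linarith

/-- The sum of `f` over the window of radius `r` about `x`. -/
noncomputable def windowSum (r : ℕ) (f : ℤ → ℝ) (x : ℤ) : ℝ :=
  ∑ z ∈ Finset.Icc (-(r : ℤ)) r, f (x + z)

theorem windowSum_reflect (r : ℕ) (f : ℤ → ℝ) (x : ℤ) :
    windowSum r f x = ∑ z ∈ Finset.Icc (-(r : ℤ)) r, f (x - z) := by
  unfold windowSum
  refine Finset.sum_nbij' (fun z => -z) (fun z => -z) ?_ ?_ ?_ ?_ ?_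
  · intro z hz; rw [Finset.mem_Icc] at hz ⊢; omega
  · intro z hz; rw [Finset.mem_Icc] at hz ⊢; omega
  · simp
  · simp
  · simp

theorem IsASU.apply_sub_le_apply_add {f : ℤ → ℝ} {a : ℤ} (hf : IsASU f a) {z : ℤ} (hz : 0 ≤ z) :
    f (a - z) ≤ f (a + z) := by
  lift z to ℕ using hz
  exact (hf z).1

theorem IsASU.apply_add_succ_le_apply_sub {f : ℤ → ℝ} {a : ℤ} (hf : IsASU f a) {z : ℤ}
    (hz : 0 ≤ z) : f (a + z + 1) ≤ f (a - z) := by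
  lift z to ℕ using hz
  exact (hf z).2

/-- The two defining inequalities come from antisymmetric differences of `f`: one about `0` (`c =
0`), one about `-1/2` (`c = -1`). -/
theorem IsASU.windowSum {f : ℤ → ℝ} {a : ℤ} (hf : IsASU f a) (r : ℕ) :
    IsASU (windowSum r f) a := by
  intro n
  constructor
  · have := sum_Icc_nonneg_of_antisymmetric (h := fun z => f (a + z) - f (a - z)) (c := 0) le_rfl
      (by norm_num) (fun z => by simp [sub_eq_add_neg])
      (fun z hz => sub_nonneg.2 (hf.apply_sub_le_apply_add hz)) n r
    rw [Finset.sum_sub_distrib, sub_nonneg] at this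
    rw [windowSum_reflect]
    unfold _root_.windowSum
    simpa only [sub_sub, add_assoc] using this
  · have := sum_Icc_nonneg_of_antisymmetric (h := fun z => f (a - z) - f (a + z + 1)) (c := -1)
      (by norm_num) le_rfl (fun z => by
        rw [neg_sub]; congr 2 <;> ring)
      (fun z hz => sub_nonneg.2 (hf.apply_add_succ_le_apply_sub hz)) n r
    rw [Finset.sum_sub_distrib, sub_nonneg] at this
    rw [windowSum_reflect r f (a - n)]
    unfold _root_.windowSum
    refine le_of_eq_of_le (Finset.sum_congr rfl fun z _ => ?_)
      (this.trans_eq (Finset.sum_congr rfl fun z _ => ?_)) <;> congr 1 <;> ring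

/-! ### Majorization and window sums -/

/-- `f` and `g` have the same total mass, and no finite set carries more `g`-mass than the initial
segment of the same size, in the order `a, a+1, a-1, …`, carries `f`-mass. -/
structure CentreMajorizes (a : ℤ) (f g : ℤ → ℝ) : Prop where
  sum_le : ∀ D : Finset ℤ,
    ∑ x ∈ D, g x ≤ ∑ k ∈ Finset.range D.card, f (a + centreOrder k)
  mass : ∃ m, HasSum f m ∧ HasSum g m

theorem sum_le_sum_range_centreOrder {f : ℤ → ℝ} {a : ℤ} (hf : IsASU f a) (D : Finset ℤ) :
    ∑ x ∈ D, f x ≤ ∑ k ∈ Finset.range D.card, f (a + centreOrder k) := by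
  have h := sum_le_sum_range_card (isASU_iff_antitone.1 hf)
    (D.map (centreEquivAt a).symm.toEmbedding)
  rw [Finset.sum_map, Finset.card_map] at h
  refine le_of_eq_of_le (Finset.sum_congr rfl fun x _ => ?_) h
  exact congrArg f ((centreEquivAt a).apply_symm_apply x).symm

theorem IsASU.centreMajorizes_self {f : ℤ → ℝ} {a : ℤ} (hf : IsASU f a) (hs : Summable f) :
    CentreMajorizes a f f :=
  ⟨sum_le_sum_range_centreOrder hf, _, hs.hasSum, hs.hasSum⟩

theorem IsASU.sum {ι : Type*} {s : Finset ι} {c : ι → ℝ} {f : ι → ℤ → ℝ} {a : ℤ}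
    (hc : ∀ i ∈ s, 0 ≤ c i) (hf : ∀ i ∈ s, IsASU (f i) a) :
    IsASU (fun x => ∑ i ∈ s, c i * f i x) a := fun n =>
  ⟨Finset.sum_le_sum fun i hi => mul_le_mul_of_nonneg_left (hf i hi n).1 (hc i hi),
    Finset.sum_le_sum fun i hi => mul_le_mul_of_nonneg_left (hf i hi n).2 (hc i hi)⟩

theorem CentreMajorizes.sum {ι : Type*} {s : Finset ι} {c : ι → ℝ} {f g : ι → ℤ → ℝ} {a : ℤ}
    (hc : ∀ i ∈ s, 0 ≤ c i) (h : ∀ i ∈ s, CentreMajorizes a (f i) (g i)) :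
    CentreMajorizes a (fun x => ∑ i ∈ s, c i * f i x) (fun x => ∑ i ∈ s, c i * g i x) := by
  constructor
  · intro D
    rw [Finset.sum_comm, Finset.sum_comm (s := Finset.range D.card)]
    refine Finset.sum_le_sum fun i hi => ?_
    rw [← Finset.mul_sum, ← Finset.mul_sum]
    exact mul_le_mul_of_nonneg_left ((h i hi).sum_le D) (hc i hi)
  · have : ∀ i : ι, ∃ m, i ∈ s → HasSum (f i) m ∧ HasSum (g i) m := fun i => by
      by_cases hi : i ∈ s
      · obtain ⟨m, hm⟩ := (h i hi).mass
        exact ⟨m, fun _ => hm⟩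
      · exact ⟨0, fun h => absurd h hi⟩
    choose m hm using this
    exact ⟨∑ i ∈ s, c i * m i, hasSum_sum fun i hi => (hm i hi).1.mul_left _,
      hasSum_sum fun i hi => (hm i hi).2.mul_left _⟩

/-- The number of points of `A` at distance at most `r` from `y`. -/
def windowCount (r : ℕ) (A : Finset ℤ) (y : ℤ) : ℕ :=
  (A.filter fun x => (x - y).natAbs ≤ r).card

theorem sum_windowCount (r : ℕ) (A D : Finset ℤ) :
    ∑ y ∈ D, windowCount r A y = closePairs r A D := by
  simp only [windowCount, closePairs, Finset.card_filter, Finset.sum_product]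
  rw [Finset.sum_comm]

theorem windowSum_eq_sum_Icc (r : ℕ) (f : ℤ → ℝ) (x : ℤ) :
    windowSum r f x = ∑ y ∈ Finset.Icc (x - r) (x + r), f y := by
  unfold windowSum
  refine Finset.sum_nbij' (fun z => x + z) (fun y => y - x) ?_ ?_ ?_ ?_ ?_
  · intro z hz; rw [Finset.mem_Icc] at hz ⊢; omega
  · intro z hz; rw [Finset.mem_Icc] at hz ⊢; omega
  · intro z _; ring
  · intro z _; ring
  · intro z _; rfl

theorem windowSum_eq_sum_of_support {f : ℤ → ℝ} {X : Finset ℤ} (hX : ∀ y, y ∉ X → f y = 0)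
    (r : ℕ) (x : ℤ) :
    windowSum r f x = ∑ y ∈ X, if (x - y).natAbs ≤ r then f y else 0 := by
  rw [windowSum_eq_sum_Icc, ← Finset.sum_filter]
  symm
  refine Finset.sum_subset ?_ ?_
  · intro y hy
    have := (Finset.mem_filter.1 hy).2
    rw [Finset.mem_Icc]
    omega
  · intro y hy hy'
    refine hX y fun hyX => hy' (Finset.mem_filter.2 ⟨hyX, ?_⟩)
    rw [Finset.mem_Icc] at hy
    omega

theorem windowCount_eq_windowSum (r : ℕ) (A : Finset ℤ) (y : ℤ) :
    (windowCount r A y : ℝ) = windowSum r (fun x => if x ∈ A then 1 else 0) y := by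
  rw [windowSum_eq_sum_of_support (X := A) (fun x hx => if_neg hx), windowCount,
    Finset.card_filter]
  push_cast
  refine Finset.sum_congr rfl fun x hx => ?_
  rw [if_pos hx, ← Int.natAbs_neg, neg_sub]

/-- Double counting. With `exists_sum_windowSum_eq`, it expresses the sum of window sums over `A` as
a maximum over finite sets `D`. -/
theorem sum_mul_windowCount_le {f : ℤ → ℝ} (hf : ∀ x, 0 ≤ f x) (r : ℕ) (A D : Finset ℤ) :
    ∑ y ∈ D, f y * windowCount r A y ≤ ∑ x ∈ A, windowSum r f x := by
  have h : ∀ y, f y * (windowCount r A y : ℝ) =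
      ∑ x ∈ A, if (x - y).natAbs ≤ r then f y else 0 := fun y => by
    rw [windowCount, Finset.card_filter]
    push_cast
    rw [Finset.mul_sum]
    simp
  simp_rw [h]
  rw [Finset.sum_comm]
  refine Finset.sum_le_sum fun x _ => ?_
  rw [windowSum_eq_sum_Icc, ← Finset.sum_filter]
  refine Finset.sum_le_sum_of_subset_of_nonneg (fun y hy => ?_) fun y _ _ => hf y
  have := (Finset.mem_filter.1 hy).2
  rw [Finset.mem_Icc]
  omega

theorem exists_sum_windowSum_eq (f : ℤ → ℝ) (r : ℕ) (A : Finset ℤ) :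
    ∃ D : Finset ℤ, ∑ x ∈ A, windowSum r f x = ∑ y ∈ D, f y * windowCount r A y := by
  refine ⟨A.biUnion fun x => Finset.Icc (x - r) (x + r), ?_⟩
  have h : ∀ y, f y * (windowCount r A y : ℝ) =
      ∑ x ∈ A, if (x - y).natAbs ≤ r then f y else 0 := fun y => by
    rw [windowCount, Finset.card_filter]
    push_cast
    rw [Finset.mul_sum]
    simp
  simp_rw [h]
  rw [Finset.sum_comm]
  refine Finset.sum_congr rfl fun x hx => ?_
  rw [windowSum_eq_sum_Icc, ← Finset.sum_filter]
  refine Finset.sum_congr ?_ fun _ _ => rfl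
  ext y
  simp only [Finset.mem_filter, Finset.mem_biUnion, Finset.mem_Icc]
  constructor
  · intro hy
    exact ⟨⟨x, hx, hy⟩, by omega⟩
  · rintro ⟨_, hy⟩
    omega

theorem antitone_windowCount_centreOrder (r n : ℕ) :
    Antitone fun k => (windowCount r ((Finset.range n).image centreOrder) (centreOrder k) : ℝ) := by
  have h : IsASU (fun x => if x ∈ (Finset.range n).image centreOrder then (1 : ℝ) else 0) 0 := by
    rw [isASU_iff_antitone]
    intro i j hij
    have hmem : ∀ k, 0 + centreOrder k ∈ (Finset.range n).image centreOrder ↔ k < n := fun k => by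
      rw [zero_add, Finset.mem_image]
      constructor
      · rintro ⟨l, hl, he⟩
        rw [← centreEquiv.injective he]
        exact Finset.mem_range.1 hl
      · exact fun hk => ⟨k, Finset.mem_range.2 hk, rfl⟩
    simp only [hmem]
    split_ifs <;> first | omega | norm_num
  have := isASU_iff_antitone.1 (h.windowSum r)
  simpa only [windowCount_eq_windowSum, zero_add] using this

theorem hasSum_windowSum {f : ℤ → ℝ} {m : ℝ} (hf : HasSum f m) (r : ℕ) :
    HasSum (windowSum r f) (∑ _z ∈ Finset.Icc (-(r : ℤ)) r, m) :=
  hasSum_sum fun z _ => (Equiv.addRight z).hasSum_iff.2 hf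

/-- The Riesz step: write the sum over `A` as a pairing of `g` with `windowCount r A`. The first
factor is dominated by `f`, the second, by the close-pair bound, by the counts of the centred
segment of the same size. -/
theorem CentreMajorizes.windowSum {f g : ℤ → ℝ} {a : ℤ} (h : CentreMajorizes a f g)
    (hf0 : ∀ x, 0 ≤ f x) (hg0 : ∀ x, 0 ≤ g x) (r : ℕ) :
    CentreMajorizes a (windowSum r f) (windowSum r g) := by
  constructor
  · intro A
    obtain ⟨D, hD⟩ := exists_sum_windowSum_eq g r A
    rw [hD]
    refine (sum_mul_le_of_dominated (f := fun k => f (a + centreOrder k))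
      (w := fun k => (windowCount r ((Finset.range A.card).image centreOrder)
        (centreOrder k) : ℝ)) (fun x _ => hg0 x) (fun D' _ => h.sum_le D') (fun D' _ => ?_)
      (antitone_windowCount_centreOrder r _) fun k _ => Nat.cast_nonneg _).trans ?_
    · have := closePairs_le_closePairs_centreOrder r A D'
      rw [← sum_windowCount, ← sum_windowCount,
        Finset.sum_image (show Function.Injective centreOrder from centreEquiv.injective).injOn]
        at this
      exact_mod_cast this
    · have := sum_mul_windowCount_le (f := fun y => f (a + y)) (fun y => hf0 _) r
        ((Finset.range A.card).image centreOrder) ((Finset.range D.card).image centreOrder)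
      rw [Finset.sum_image (show Function.Injective centreOrder from centreEquiv.injective).injOn,
        Finset.sum_image (show Function.Injective centreOrder from centreEquiv.injective).injOn]
        at this
      refine this.trans_eq (Finset.sum_congr rfl fun k _ => ?_)
      unfold _root_.windowSum
      simp only [add_assoc]
  · obtain ⟨m, hf, hg⟩ := h.mass
    exact ⟨_, hasSum_windowSum hf r, hasSum_windowSum hg r⟩

/-! ### Majorization and distortion -/

theorem exists_sum_range_centreOrder_eq {f : ℤ → ℝ} (hfin : f.support.Finite) {m : ℝ}
    (hm : HasSum f m) (a : ℤ) :
    ∃ N, ∀ n ≥ N, ∑ k ∈ Finset.range n, f (a + centreOrder k) = m := by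
  obtain ⟨N, hN⟩ := (hfin.preimage (centreEquivAt a).injective.injOn).bddAbove
  refine ⟨N + 1, fun n hn => ?_⟩
  have h1 : HasSum (fun k => f (a + centreOrder k)) m := (centreEquivAt a).hasSum_iff.2 hm
  refine (hasSum_sum_of_ne_finset_zero fun k hk => ?_).unique h1
  by_contra hne
  have := hN (show k ∈ centreEquivAt a ⁻¹' f.support from hne)
  rw [Finset.mem_range] at hk
  omega

theorem card_le_of_forall_natAbs_lt {D : Finset ℤ} {b : ℤ} {n : ℕ}
    (h : ∀ x ∈ D, 2 * (x - b).natAbs < n) : D.card ≤ n := by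
  have hsub : D ⊆ Finset.Icc (b - ((n - 1) / 2 : ℕ)) (b + ((n - 1) / 2 : ℕ)) := fun x hx => by
    have := h x hx
    rw [Finset.mem_Icc]
    omega
  rcases D.eq_empty_or_nonempty with rfl | ⟨x, hx⟩
  · simp
  have h1 := h x hx
  have := Finset.card_le_card hsub
  rw [Int.card_Icc] at this
  omega

/-- Remove the point farthest from `b`: `n + 1` integers cannot all lie closer to `b` than the
`n`-th centred point lies to `0`. -/
theorem sum_natAbs_centreOrder_le {d : ℕ → ℝ} (hd : Monotone d) (b : ℤ) (D : Finset ℤ) :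
    ∑ k ∈ Finset.range D.card, d (centreOrder k).natAbs ≤ ∑ x ∈ D, d (x - b).natAbs := by
  induction hn : D.card generalizing D with
  | zero => rw [Finset.card_eq_zero] at hn; simp [hn]
  | succ n ih =>
    obtain ⟨x, hx, hmax⟩ := Finset.exists_max_image D (fun x => (x - b).natAbs)
      (Finset.card_pos.1 (by omega))
    rw [Finset.sum_range_succ, ← Finset.sum_erase_add _ _ hx]
    refine add_le_add (ih _ (by rw [Finset.card_erase_of_mem hx]; omega)) (hd ?_)
    by_contra! hlt
    rw [natAbs_centreOrder] at hlt
    have := card_le_of_forall_natAbs_lt (D := D) (b := b) (n := n) fun y hy => by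
      have := hmax y hy
      omega
    omega

theorem CentreMajorizes.sum_distortion_le {f g : ℤ → ℝ} {a : ℤ} (h : CentreMajorizes a f g)
    (hg0 : ∀ x, 0 ≤ g x) {d : ℕ → ℝ} (hd : Monotone d) (b : ℤ)
    {X Y : Finset ℤ} (hX : ∀ x, x ∉ X → f x = 0) (hY : ∀ x, x ∉ Y → g x = 0) :
    ∑ x ∈ X, f x * d (x - a).natAbs ≤ ∑ x ∈ Y, g x * d (x - b).natAbs := by
  have hsupp : ∀ {u : ℤ → ℝ} {S : Finset ℤ}, (∀ x, x ∉ S → u x = 0) → u.support.Finite :=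
    fun {u S} hu => S.finite_toSet.subset fun x hx => by
      by_contra hxS
      exact hx (hu x hxS)
  obtain ⟨m, hfm, hgm⟩ := h.mass
  have hfX : HasSum (fun x => f x * d (x - a).natAbs) (∑ x ∈ X, f x * d (x - a).natAbs) :=
    hasSum_sum_of_ne_finset_zero fun x hx => by rw [hX x hx, zero_mul]
  have hgY : HasSum (fun x => g x * d (x - b).natAbs) (∑ x ∈ Y, g x * d (x - b).natAbs) :=
    hasSum_sum_of_ne_finset_zero fun x hx => by rw [hY x hx, zero_mul]
  obtain ⟨N1, h1⟩ := exists_sum_range_centreOrder_eq (hsupp hX) hfm a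
  obtain ⟨N2, h2⟩ := exists_sum_range_centreOrder_eq (hsupp hY) hgm a
  obtain ⟨N3, h3⟩ := exists_sum_range_centreOrder_eq
    (hsupp (S := X) fun x hx => by simp [hX x hx]) hfX a
  obtain ⟨N4, h4⟩ := exists_sum_range_centreOrder_eq
    (hsupp (S := Y) fun x hx => by simp [hY x hx]) hgY a
  set n := max (max N1 N2) (max N3 N4) with hn
  have e1 := h1 n (by omega)
  have e2 := h2 n (by omega)
  have e3 := h3 n (by omega)
  have e4 := h4 n (by omega)
  have himg : ∀ (u : ℤ → ℝ) (D : Finset ℕ), ∑ k ∈ D, u (a + centreOrder k) =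
      ∑ x ∈ D.image fun k => a + centreOrder k, u x := fun u D =>
    (Finset.sum_image (centreOrder_injective a).injOn).symm
  -- Subtracting from `d n` turns the increasing distortion into a decreasing weight, nonnegative on
  -- the first `n` centred points. Since `n` exhausts both supports and the masses agree, the
  -- constant cancels.
  have key := sum_mul_le_of_dominated (D := Finset.range n)
    (f' := fun k => g (a + centreOrder k)) (f := fun k => f (a + centreOrder k))
    (w' := fun k => d n - d (a + centreOrder k - b).natAbs)
    (w := fun k => d n - d (centreOrder k).natAbs) (fun k _ => hg0 _)
    (fun D _ => by
      rw [himg g, ← Finset.card_image_of_injective D (centreOrder_injective a)]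
      exact h.sum_le _)
    (fun D _ => by
      rw [Finset.sum_sub_distrib, Finset.sum_sub_distrib, himg fun x => d (x - b).natAbs]
      have := sum_natAbs_centreOrder_le hd b (D.image fun k => a + centreOrder k)
      rw [Finset.card_image_of_injective D (centreOrder_injective a)] at this
      simp only [Finset.sum_const, Finset.card_range]
      linarith)
    (fun i j hij => by
      have : d (centreOrder i).natAbs ≤ d (centreOrder j).natAbs := hd (by
        rw [natAbs_centreOrder, natAbs_centreOrder]; omega)
      dsimp only
      linarith)
    (fun k hk => sub_nonneg.2 (hd (by
      rw [Finset.card_range] at hk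
      rw [natAbs_centreOrder]; omega)))
  rw [Finset.card_range] at key
  simp only [mul_sub, Finset.sum_sub_distrib, ← Finset.sum_mul, e1, e2] at key
  simp only [add_sub_cancel_left] at e3
  linarith

/-! ### Filling a prescribed silent mass from the centre -/

theorem exists_threshold {f : ℤ → ℝ} {a : ℤ} (hf : IsASU f a) (hf0 : ∀ x, 0 ≤ f x)
    (hfin : f.support.Finite) {M m : ℝ} (hM : HasSum f M) (hm0 : 0 ≤ m) (hmM : m ≤ M) :
    ∃ g : ℤ → ℝ, (∀ x, 0 ≤ g x ∧ g x ≤ 1) ∧ IsThreshold g a ∧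
      IsASU (fun x => f x * (1 - g x)) a ∧ HasSum (fun x => f x * (1 - g x)) m ∧
      ∀ n, ∑ k ∈ Finset.range n, f (a + centreOrder k) * (1 - g (a + centreOrder k)) =
        min (∑ k ∈ Finset.range n, f (a + centreOrder k)) m := by
  classical
  set x : ℕ → ℝ := fun k => f (a + centreOrder k) with hx
  have hx0 : ∀ k, 0 ≤ x k := fun k => hf0 _
  have hanti : Antitone x := isASU_iff_antitone.1 hf
  set S : ℕ → ℝ := fun n => ∑ k ∈ Finset.range n, x k with hS
  have hSs : ∀ n, S (n + 1) = S n + x n := fun n => Finset.sum_range_succ _ _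
  have hSmono : Monotone S := monotone_nat_of_le_succ fun n => by linarith [hSs n, hx0 n]
  obtain ⟨N, hN⟩ := exists_sum_range_centreOrder_eq hfin hM a
  have hSN : ∀ n ≥ N, S n = M := hN
  have hex : ∃ n, m ≤ S (n + 1) := ⟨N, by rw [hSN (N + 1) (by omega)]; exact hmM⟩
  set n := Nat.find hex with hn
  have hn1 : m ≤ S (n + 1) := Nat.find_spec hex
  have hn0 : S n ≤ m := by
    rcases hcase : n with _ | l
    · simpa [hS] using hm0
    · have := Nat.find_min hex (m := l) (by omega)
      linarith
  -- The silent fraction at the boundary state. If `x n = 0` the quotient is 0 by convention, which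
  -- is harmless because then `m = S n`.
  set q := (m - S n) / x n with hq
  have hq0 : 0 ≤ q := div_nonneg (by linarith) (hx0 n)
  have hq1 : q ≤ 1 := div_le_one_of_le₀ (by linarith [hSs n]) (hx0 n)
  have hxq : x n * q = m - S n := by
    rcases eq_or_ne (x n) 0 with h0 | h0
    · have := hSs n
      rw [h0, zero_mul]
      linarith
    · exact mul_div_cancel₀ _ h0
  set y : ℕ → ℝ := fun k => if k < n then 0 else if k = n then 1 - q else 1 with hy
  have hy01 : ∀ k, 0 ≤ y k ∧ y k ≤ 1 := fun k => by
    simp only [hy]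
    split_ifs <;> constructor <;> linarith
  set g : ℤ → ℝ := fun z => y ((centreEquivAt a).symm z) with hg
  have hgk : ∀ k, g (a + centreOrder k) = y k := fun k =>
    congrArg y ((centreEquivAt a).symm_apply_apply k)
  have hpart : ∀ l, ∑ k ∈ Finset.range l, x k * (1 - y k) = min (S l) m := by
    intro l
    induction l with
    | zero => simp [hS, hm0]
    | succ l ih =>
      rw [Finset.sum_range_succ, ih]
      rcases lt_trichotomy l n with hl | hl | hl
      · have h1 : S (l + 1) ≤ S n := hSmono hl
        have h2 : S l ≤ S (l + 1) := hSmono (Nat.le_succ l)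
        rw [min_eq_left (by linarith), min_eq_left (by linarith), hSs]
        simp [hy, hl]
      · rw [hl, min_eq_left hn0, min_eq_right hn1]
        have : y n = 1 - q := by simp [hy]
        rw [this, sub_sub_cancel, hxq]
        ring
      · have h1 : S (n + 1) ≤ S l := hSmono hl
        have h2 : S l ≤ S (l + 1) := hSmono (Nat.le_succ l)
        rw [min_eq_right (by linarith), min_eq_right (by linarith)]
        have : y l = 1 := by
          simp only [hy]
          rw [if_neg (by omega), if_neg (by omega)]
        rw [this]
        ring
  refine ⟨g, fun z => hy01 _, ⟨n, 1 - q, by linarith, by linarith, fun k => ?_⟩, ?_, ?_, ?_⟩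
  · rw [hgk]
    refine ⟨fun h => ?_, fun h => ?_, fun h => ?_⟩
    · simp [hy, h]
    · simp [hy, h]
    · simp only [hy]
      rw [if_neg (by omega), if_neg (by omega)]
  · rw [isASU_iff_antitone]
    simp only [hgk]
    intro i j hij
    have h1 : y i ≤ y j := by
      simp only [hy]
      split_ifs <;> first | omega | linarith
    exact mul_le_mul (hanti hij) (by linarith) (by linarith [(hy01 j).2]) (hx0 i)
  · have hfin' : (fun z => f z * (1 - g z)).support.Finite :=
      hfin.subset (Function.support_mul_subset_left _ _)
    have hs := (show Summable (fun z => f z * (1 - g z)) from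
      summable_of_hasFiniteSupport hfin').hasSum
    obtain ⟨N', hN'⟩ := exists_sum_range_centreOrder_eq hfin' hs a
    have h1 := hN' (max N N') (le_max_right _ _)
    simp only [hgk] at h1
    rw [hpart, hSN _ (le_max_left _ _), min_eq_right hmM] at h1
    rwa [h1]
  · intro l
    simp only [hgk]
    exact hpart l

/-! ### Regular functionals on weights -/

namespace RemoteEstimation

variable {M : RemoteEstimation}

/-- The total mass of a weight. -/
noncomputable def totalMass : M.Weight →+ ℝ :=
  Finsupp.liftAddHom fun _ => AddMonoidHom.id ℝ

theorem totalMass_apply (u : M.Weight) : totalMass u = u.sum fun _ p => p := rfl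

theorem totalMass_single (s : M.State) (p : ℝ) :
    totalMass (Finsupp.single s p : M.Weight) = p := by
  simp [totalMass_apply]

theorem exists_cover (u : M.Weight) : ∃ X : Finset ℤ, ∀ x, x ∉ X → ∀ e, u (x, e) = 0 := by
  classical
  refine ⟨u.support.image Prod.fst, fun x hx e => ?_⟩
  by_contra h
  exact hx (Finset.mem_image.2 ⟨(x, e), Finsupp.mem_support_iff.2 h, rfl⟩)

theorem sum_eq_sum_slices {u : M.Weight} {X : Finset ℤ} (hX : ∀ x, x ∉ X → ∀ e, u (x, e) = 0)
    (F : M.State → ℝ) :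
    (u.sum fun s p => p * F s) = ∑ e, ∑ x ∈ X, u (x, e) * F (x, e) := by
  rw [Finsupp.sum_of_support_subset u (s := X ×ˢ Finset.univ) ?_ _ (by simp),
    Finset.sum_product, Finset.sum_comm]
  rintro ⟨x, e⟩ hs
  rw [Finset.mem_product]
  refine ⟨?_, Finset.mem_univ _⟩
  by_contra h
  exact Finsupp.mem_support_iff.1 hs (hX x h e)

theorem hasSum_slice {u : M.Weight} {X : Finset ℤ} (hX : ∀ x, x ∉ X → ∀ e, u (x, e) = 0)
    (e : Fin (M.B + 1)) : HasSum (fun x => u (x, e)) (∑ x ∈ X, u (x, e)) :=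
  hasSum_sum_of_ne_finset_zero fun x hx => hX x hx e

theorem finite_support_slice (u : M.Weight) (e : Fin (M.B + 1)) :
    (fun x => u (x, e)).support.Finite := by
  obtain ⟨X, hX⟩ := exists_cover u
  refine X.finite_toSet.subset fun x hx => ?_
  by_contra h
  exact hx (hX x h e)

/-- The properties of the value functions that are propagated by the dynamic program. -/
structure IsRegular (v : M.Weight → ℝ) : Prop where
  map_smul : ∀ l : ℝ, 0 ≤ l → ∀ u : M.Weight, (∀ s, 0 ≤ u s) → v (l • u) = l * v u
  superadditive : ∀ u u' : M.Weight, (∀ s, 0 ≤ u s) → (∀ s, 0 ≤ u' s) → v u + v u' ≤ v (u + u')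
  lower_bound : ∃ K, 0 ≤ K ∧ ∀ u : M.Weight, (∀ s, 0 ≤ u s) → -(K * totalMass u) ≤ v u
  mono : ∀ (a : ℤ) (u u' : M.Weight), (∀ s, 0 ≤ u s) → (∀ s, 0 ≤ u' s) →
    (∀ e, IsASU (fun x => u (x, e)) a) →
    (∀ e, CentreMajorizes a (fun x => u (x, e)) fun x => u' (x, e)) → v u ≤ v u'

theorem IsRegular.zero : IsRegular fun _ : M.Weight => 0 where
  map_smul := by simp
  superadditive := by simp
  lower_bound := ⟨0, le_rfl, by simp⟩
  mono := by simp

theorem IsRegular.add {v w : M.Weight → ℝ} (hv : IsRegular v) (hw : IsRegular w) :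
    IsRegular fun u => v u + w u where
  map_smul l hl u hu := by rw [hv.map_smul l hl u hu, hw.map_smul l hl u hu, mul_add]
  superadditive u u' hu hu' := by
    linarith [hv.superadditive u u' hu hu', hw.superadditive u u' hu hu']
  lower_bound := by
    obtain ⟨K, hK, h⟩ := hv.lower_bound
    obtain ⟨K', hK', h'⟩ := hw.lower_bound
    exact ⟨K + K', add_nonneg hK hK', fun u hu => by linarith [h u hu, h' u hu]⟩
  mono a u u' hu hu' h1 h2 := add_le_add (hv.mono a u u' hu hu' h1 h2) (hw.mono a u u' hu hu' h1 h2)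

section Distortion

theorem neg_abs_mul_totalMass_le (u : M.Weight) (hu : ∀ s, 0 ≤ u s) (a : ℤ) :
    -(|M.d 0| * totalMass u) ≤ u.sum fun s p => p * M.dist s.1 a := by
  rw [totalMass_apply, Finsupp.mul_sum, Finsupp.sum, Finsupp.sum, ← Finset.sum_neg_distrib]
  refine Finset.sum_le_sum fun s _ => ?_
  have h1 : -|M.d 0| ≤ M.dist s.1 a := (neg_abs_le _).trans (M.d_mono (Nat.zero_le _))
  have h2 := mul_le_mul_of_nonneg_left h1 (hu s)
  linarith

theorem bddBelow_distortion (u : M.Weight) (hu : ∀ s, 0 ≤ u s) :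
    BddBelow (Set.range fun a : ℤ => u.sum fun s p => p * M.dist s.1 a) :=
  ⟨_, by rintro _ ⟨a, rfl⟩; exact neg_abs_mul_totalMass_le u hu a⟩

/-- An infimum of linear functionals is homogeneous and superadditive. For monotonicity, the
estimate `a` for the concentrated weight is compared with an arbitrary estimate `b` for the other.
-/
theorem isRegular_minDistortion : IsRegular M.minDistortion where
  map_smul l hl u hu := by
    unfold minDistortion
    rw [Real.mul_iInf_of_nonneg hl]
    congr 1
    funext a
    rw [Finsupp.sum_smul_index (by simp), Finsupp.mul_sum]
    simp only [mul_assoc]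
  superadditive u u' hu hu' := by
    refine le_ciInf fun a => ?_
    rw [Finsupp.sum_add_index' (by simp) (by intros; ring)]
    exact add_le_add (ciInf_le (bddBelow_distortion u hu) a) (ciInf_le (bddBelow_distortion u' hu') a)
  lower_bound := ⟨|M.d 0|, abs_nonneg _, fun u hu => le_ciInf (neg_abs_mul_totalMass_le u hu)⟩
  mono a u u' hu hu' _ h := by
    obtain ⟨X, hX⟩ := exists_cover u
    obtain ⟨Y, hY⟩ := exists_cover u'
    refine le_ciInf fun b => (ciInf_le (bddBelow_distortion u hu) a).trans ?_
    rw [sum_eq_sum_slices hX fun s => M.dist s.1 a, sum_eq_sum_slices hY fun s => M.dist s.1 b]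
    exact Finset.sum_le_sum fun e _ => (h e).sum_distortion_le (fun x => hu' _) M.d_mono b
      (fun x hx => hX x hx e) fun x hx => hY x hx e

end Distortion

section Predict

theorem noise_succ_le (r : ℕ) : M.noise ((r : ℤ) + 1) ≤ M.noise r := by
  have h1 := (M.noise_asu r).2
  rw [zero_sub, M.noise_even, zero_add] at h1
  exact h1

/-- Layer-cake decomposition: evenness and unimodality make the noise a nonnegative combination of
window indicators, by telescoping in `r`. -/
theorem exists_noise_eq_sum : ∃ R : ℕ, ∀ z, M.noise z =
    ∑ r ∈ Finset.range R, (M.noise r - M.noise ((r : ℤ) + 1)) * if z.natAbs ≤ r then 1 else 0 := by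
  obtain ⟨R, hR⟩ := (M.noise.support.image Int.natAbs).bddAbove
  have hzero : ∀ z : ℤ, R < z.natAbs → M.noise z = 0 := fun z hz => by
    by_contra h
    have := hR (Finset.mem_coe.2 (Finset.mem_image_of_mem _ (Finsupp.mem_support_iff.2 h)))
    omega
  have habs : ∀ z : ℤ, M.noise z = M.noise (z.natAbs : ℤ) := fun z => by
    rcases Int.natAbs_eq z with h | h
    · rw [← h]
    · conv_lhs => rw [h]
      exact M.noise_even _
  have htel : ∀ n : ℕ, ∀ z : ℤ,
      ∑ r ∈ Finset.range n, (M.noise r - M.noise ((r : ℤ) + 1)) * (if z.natAbs ≤ r then 1 else 0) =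
        if z.natAbs ≤ n then M.noise (z.natAbs : ℤ) - M.noise n else 0 := by
    intro n z
    induction n with
    | zero =>
      split_ifs with h
      · simp [Nat.le_zero.1 h]
      · simp
    | succ n ih =>
      rw [Finset.sum_range_succ, ih]
      push_cast
      rcases lt_trichotomy z.natAbs (n + 1) with h | h | h
      · rw [if_pos (by omega), if_pos (by omega), if_pos (by omega)]
        ring
      · rw [if_neg (by omega), if_neg (by omega), if_pos (by omega), Int.abs_eq_natAbs, h]
        push_cast
        ring
      · rw [if_neg (by omega), if_neg (by omega), if_neg (by omega)]
        ring
  refine ⟨R + 1, fun z => ?_⟩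
  rw [htel, hzero ((R + 1 : ℕ) : ℤ) (by omega), sub_zero, ← habs]
  split_ifs with h
  · rfl
  · exact hzero z (by omega)

theorem exists_predict_eq_sum (t : ℕ) (e : Fin (M.B + 1)) :
    ∃ (I : Finset (Fin (M.B + 1) × ℕ)) (c : Fin (M.B + 1) × ℕ → ℝ), (∀ i ∈ I, 0 ≤ c i) ∧
      ∀ u : M.Weight, (fun x => M.predict t u (x, e)) =
        fun x => ∑ i ∈ I, c i * windowSum i.2 (fun y => u (y, i.1)) x := by
  obtain ⟨R, hR⟩ := M.exists_noise_eq_sum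
  refine ⟨Finset.univ ×ˢ Finset.range R,
    fun i => M.harvest t i.1 e * (M.noise i.2 - M.noise ((i.2 : ℤ) + 1)), fun i _ =>
      mul_nonneg (M.harvest_nonneg _ _ _) (sub_nonneg.2 (M.noise_succ_le _)), fun u => ?_⟩
  funext x
  obtain ⟨X, hX⟩ := exists_cover u
  rw [predict_apply]
  have h1 := sum_eq_sum_slices hX fun s => M.noise (x - s.1) * M.harvest t s.2 e
  rw [show (u.sum fun s p => M.noise (x - s.1) * M.harvest t s.2 e * p) =
    u.sum fun s p => p * (M.noise (x - s.1) * M.harvest t s.2 e) from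
    Finsupp.sum_congr fun _ _ => mul_comm _ _, h1, Finset.sum_product]
  refine Finset.sum_congr rfl fun e' _ => ?_
  simp_rw [windowSum_eq_sum_of_support fun y (hy : y ∉ X) => hX y hy e', Finset.mul_sum]
  rw [Finset.sum_comm]
  refine Finset.sum_congr rfl fun y _ => ?_
  rw [hR (x - y), Finset.sum_mul, Finset.mul_sum]
  refine Finset.sum_congr rfl fun r _ => ?_
  split_ifs <;> ring

theorem predict_nonneg (t : ℕ) {u : M.Weight} (hu : ∀ s, 0 ≤ u s) (s : M.State) :
    0 ≤ M.predict t u s := by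
  obtain ⟨x, e⟩ := s
  rw [predict_apply]
  exact Finset.sum_nonneg fun s _ =>
    mul_nonneg (mul_nonneg (M.noise_nonneg _) (M.harvest_nonneg _ _ _)) (hu s)

theorem predict_add (t : ℕ) (u u' : M.Weight) :
    M.predict t (u + u') = M.predict t u + M.predict t u' := by
  ext ⟨x, e⟩
  rw [Finsupp.add_apply, predict_apply, predict_apply, predict_apply,
    Finsupp.sum_add_index' (by simp) (by intros; ring)]

theorem predict_smul (t : ℕ) (l : ℝ) (u : M.Weight) :
    M.predict t (l • u) = l • M.predict t u := by
  ext ⟨x, e⟩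
  rw [Finsupp.smul_apply, predict_apply, predict_apply, Finsupp.sum_smul_index (by simp),
    smul_eq_mul, Finsupp.mul_sum]
  exact Finsupp.sum_congr fun _ _ => by ring

theorem totalMass_predict (t : ℕ) (u : M.Weight) : totalMass (M.predict t u) = totalMass u := by
  unfold predict
  rw [map_finsuppSum, totalMass_apply]
  refine Finsupp.sum_congr fun s _ => ?_
  rw [map_finsuppSum]
  simp only [map_sum, totalMass_single, ← Finset.sum_mul, ← Finset.mul_sum, M.harvest_sum, mul_one]
  rw [← Finsupp.sum_mul, M.noise_sum, one_mul]

theorem IsRegular.comp_predict {v : M.Weight → ℝ} (hv : IsRegular v) (t : ℕ) :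
    IsRegular fun u => v (M.predict t u) where
  map_smul l hl u hu := by rw [predict_smul, hv.map_smul l hl _ (predict_nonneg t hu)]
  superadditive u u' hu hu' := by
    rw [predict_add]
    exact hv.superadditive _ _ (predict_nonneg t hu) (predict_nonneg t hu')
  lower_bound := by
    obtain ⟨K, hK, h⟩ := hv.lower_bound
    refine ⟨K, hK, fun u hu => ?_⟩
    rw [← totalMass_predict t u]
    exact h _ (predict_nonneg t hu)
  mono a u u' hu hu' h1 h2 := by
    refine hv.mono a _ _ (predict_nonneg t hu) (predict_nonneg t hu') (fun e => ?_) fun e => ?_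
    · obtain ⟨I, c, hc, h⟩ := M.exists_predict_eq_sum t e
      rw [h]
      exact IsASU.sum hc fun i _ => (h1 i.1).windowSum i.2
    · obtain ⟨I, c, hc, h⟩ := M.exists_predict_eq_sum t e
      rw [h, h]
      exact CentreMajorizes.sum hc fun i _ =>
        (h2 i.1).windowSum (fun x => hu _) (fun x => hu' _) i.2

end Predict

/-! ### Cost in terms of the silent part -/

/-- The unnormalized law of `(X_t, E_t)` on the event of silence. -/
noncomputable def silentPart (π : M.Weight) (γ : M.State → ℝ) : M.Weight :=
  Finsupp.onFinset π.support (fun s => π s * (1 - γ s)) (by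
    intro s hs
    rw [Finsupp.mem_support_iff]
    intro h
    exact hs (by simp [h]))

@[simp] theorem silentPart_apply (π : M.Weight) (γ : M.State → ℝ) (s : M.State) :
    silentPart π γ s = π s * (1 - γ s) := rfl

theorem silentPart_nonneg {π : M.Weight} (hπ : ∀ s, 0 ≤ π s) {γ : M.State → ℝ}
    (hγ : IsPrescription γ) (s : M.State) : 0 ≤ silentPart π γ s :=
  mul_nonneg (hπ s) (by linarith [(hγ.1 s).2])

theorem silenceProb_eq (π : M.Weight) (γ : M.State → ℝ) :
    M.silenceProb π γ = ∑ s ∈ π.support, silentPart π γ s := rfl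

/-- In the degenerate case of silence probability 0 the silent part vanishes too, so division by
zero does no harm. -/
theorem smul_update_none {π : M.Weight} (hπ : ∀ s, 0 ≤ π s) {γ : M.State → ℝ}
    (hγ : IsPrescription γ) :
    M.silenceProb π γ • M.update π γ none = silentPart π γ := by
  ext s
  change M.silenceProb π γ * (π s * (1 - γ s) / M.silenceProb π γ) = π s * (1 - γ s)
  rcases eq_or_ne (M.silenceProb π γ) 0 with h | h
  · rw [h, zero_mul]
    rw [silenceProb_eq, Finset.sum_eq_zero_iff_of_nonneg fun s _ => silentPart_nonneg hπ hγ s] at h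
    by_cases hs : s ∈ π.support
    · exact (h s hs).symm
    · rw [Finsupp.notMem_support_iff.1 hs, zero_mul]
  · exact mul_div_cancel₀ _ h

theorem update_none_nonneg {π : M.Weight} (hπ : ∀ s, 0 ≤ π s) {γ : M.State → ℝ}
    (hγ : IsPrescription γ) (s : M.State) : 0 ≤ M.update π γ none s :=
  div_nonneg (silentPart_nonneg hπ hγ s)
    (Finset.sum_nonneg fun s _ => silentPart_nonneg hπ hγ s)

/-- The cost of a transmission in state `s`, including the cost-to-go. -/
noncomputable def transmitCost (v : M.Weight → ℝ) (s : M.State) : ℝ :=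
  M.c + v (Finsupp.single (s.1, M.spend s.2) 1)

theorem IsRegular.cost_eq {v : M.Weight → ℝ} (hv : IsRegular v) {π : M.Weight}
    (hπ : ∀ s, 0 ≤ π s) {γ : M.State → ℝ} (hγ : IsPrescription γ) :
    M.cost v π γ =
      (π.sum fun s p => p * (γ s * transmitCost v s)) + v (silentPart π γ) := by
  rw [← smul_update_none hπ hγ, hv.map_smul _ ?_ _ (update_none_nonneg hπ hγ), silenceProb,
    Finsupp.sum_mul, ← Finsupp.sum_add]
  · exact Finsupp.sum_congr fun s _ => by
      change _ * (γ s * transmitCost v s + _) = _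
      ring
  · rw [silenceProb_eq]
    exact Finset.sum_nonneg fun s _ => silentPart_nonneg hπ hγ s

theorem silentPart_smul (l : ℝ) (π : M.Weight) (γ : M.State → ℝ) :
    silentPart (l • π) γ = l • silentPart π γ := by
  ext s
  simp [mul_assoc]

theorem silentPart_add (π π' : M.Weight) (γ : M.State → ℝ) :
    silentPart (π + π') γ = silentPart π γ + silentPart π' γ := by
  ext s
  simp [add_mul]

theorem totalMass_silentPart_le {π : M.Weight} (hπ : ∀ s, 0 ≤ π s) {γ : M.State → ℝ}
    (hγ : IsPrescription γ) : totalMass (silentPart π γ) ≤ totalMass π := by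
  rw [totalMass_apply, totalMass_apply,
    Finsupp.sum_of_support_subset (silentPart π γ) (Finsupp.support_onFinset_subset) _ (by simp),
    Finsupp.sum]
  refine Finset.sum_le_sum fun s _ => ?_
  rw [silentPart_apply]
  exact mul_le_of_le_one_right (hπ s) (by linarith [(hγ.1 s).1])

theorem isPrescription_zero : IsPrescription (M := M) fun _ => 0 :=
  ⟨fun _ => ⟨le_rfl, zero_le_one⟩, fun _ => rfl⟩

instance : Nonempty {γ : M.State → ℝ // IsPrescription γ} := ⟨⟨_, isPrescription_zero⟩⟩

/-- Needed because a real infimum is meaningful only over a set bounded below; linearity in the mass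
lets the bound pass to the next value function. -/
theorem IsRegular.exists_cost_lower_bound {v : M.Weight → ℝ} (hv : IsRegular v) :
    ∃ K, 0 ≤ K ∧ ∀ π : M.Weight, (∀ s, 0 ≤ π s) → ∀ γ, IsPrescription γ →
      -(K * totalMass π) ≤ M.cost v π γ := by
  obtain ⟨K, hK, h⟩ := hv.lower_bound
  refine ⟨|M.c| + K + K, by positivity, fun π hπ γ hγ => ?_⟩
  rw [hv.cost_eq hπ hγ]
  have h1 := h _ (silentPart_nonneg hπ hγ)
  have h2 := mul_le_mul_of_nonneg_left (totalMass_silentPart_le hπ hγ) hK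
  have h3 : -((|M.c| + K) * totalMass π) ≤ π.sum fun s p => p * (γ s * transmitCost v s) := by
    rw [totalMass_apply, Finsupp.mul_sum, Finsupp.sum, Finsupp.sum, ← Finset.sum_neg_distrib]
    refine Finset.sum_le_sum fun s _ => ?_
    have h4 : -(|M.c| + K) ≤ transmitCost v s := by
      have := h (Finsupp.single (s.1, M.spend s.2) 1) fun s' => by
        rw [Finsupp.single_apply]; split_ifs <;> norm_num
      rw [totalMass_single, mul_one] at this
      unfold transmitCost
      linarith [neg_abs_le M.c]
    have h5 : -(|M.c| + K) ≤ γ s * transmitCost v s := by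
      have h6 := mul_le_mul_of_nonneg_left h4 (hγ.1 s).1
      have h7 : γ s * (|M.c| + K) ≤ |M.c| + K :=
        mul_le_of_le_one_left (by positivity) (hγ.1 s).2
      linarith
    have := mul_le_mul_of_nonneg_left h5 (hπ s)
    linarith
  linarith

theorem IsRegular.bddBelow_cost {v : M.Weight → ℝ} (hv : IsRegular v) {π : M.Weight}
    (hπ : ∀ s, 0 ≤ π s) :
    BddBelow (Set.range fun γ : {γ : M.State → ℝ // IsPrescription γ} => M.cost v π γ) := by
  obtain ⟨K, _, h⟩ := hv.exists_cost_lower_bound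
  exact ⟨_, by rintro _ ⟨γ, rfl⟩; exact h π hπ γ γ.2⟩

/-! ### The exchange argument -/

section Rearrangement

theorem isASU_single (x : ℤ) (s : M.State) (hs : s.1 = x) (e : Fin (M.B + 1)) :
    IsASU (fun y => (Finsupp.single s 1 : M.Weight) (y, e)) x := by
  obtain ⟨x', e'⟩ := s
  subst hs
  intro n
  simp only [Finsupp.single_apply, Prod.mk.injEq]
  constructor <;> split_ifs <;> first | (norm_num; done) | (exfalso; omega)

theorem centreMajorizes_single (x y : ℤ) (e' e : Fin (M.B + 1)) :
    CentreMajorizes x (fun z => (Finsupp.single (x, e') 1 : M.Weight) (z, e))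
      fun z => (Finsupp.single (y, e') 1 : M.Weight) (z, e) := by
  by_cases he : e' = e
  · subst he
    have h : ∀ x : ℤ, (fun z => (Finsupp.single (x, e') 1 : M.Weight) (z, e')) =
        fun z => if z = x then 1 else 0 := fun x => by
      funext z
      simp [Finsupp.single_apply, eq_comm]
    rw [h, h]
    refine ⟨fun D => ?_, 1, hasSum_ite_eq x 1, hasSum_ite_eq y 1⟩
    rcases D.eq_empty_or_nonempty with rfl | hD
    · simp
    · refine le_trans (b := 1) ?_ ?_
      · rw [Finset.sum_ite_eq' D y]
        split_ifs <;> norm_num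
      · refine le_of_eq_of_le ?_ (Finset.single_le_sum (fun k _ => ?_)
          (Finset.mem_range.2 (Finset.card_pos.2 hD)))
        · simp [centreOrder]
        · split_ifs <;> norm_num
  · have h : ∀ x : ℤ, (fun z => (Finsupp.single (x, e') 1 : M.Weight) (z, e)) =
        fun _ => 0 := fun x => by
      funext z
      simp [he]
    rw [h, h]
    exact ⟨fun D => by simp, 0, hasSum_zero, hasSum_zero⟩

theorem single_nonneg (s s' : M.State) : 0 ≤ (Finsupp.single s 1 : M.Weight) s' := by
  rw [Finsupp.single_apply]; split_ifs <;> norm_num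

/-- Point masses at any two positions majorize each other about their own centres, so monotonicity
applies in both directions. -/
theorem IsRegular.transmitCost_eq {v : M.Weight → ℝ} (hv : IsRegular v) (x y : ℤ)
    (e : Fin (M.B + 1)) : transmitCost v (x, e) = transmitCost v (y, e) := by
  have h : ∀ x y : ℤ, transmitCost v (x, e) ≤ transmitCost v (y, e) := fun x y =>
    add_le_add le_rfl (hv.mono x _ _ (single_nonneg _) (single_nonneg _)
      (isASU_single x _ rfl) (centreMajorizes_single x y _))
  exact le_antisymm (h x y) (h y x)

theorem IsRegular.cost_eq_of_hasSum {v : M.Weight → ℝ} (hv : IsRegular v) {π : M.Weight}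
    (hπ : ∀ s, 0 ≤ π s) {γ : M.State → ℝ} (hγ : IsPrescription γ) {m n : Fin (M.B + 1) → ℝ}
    (hm : ∀ e, HasSum (fun x => π (x, e)) (m e))
    (hn : ∀ e, HasSum (fun x => silentPart π γ (x, e)) (n e)) :
    M.cost v π γ = ∑ e, (m e - n e) * transmitCost v (0, e) + v (silentPart π γ) := by
  obtain ⟨X, hX⟩ := exists_cover π
  rw [hv.cost_eq hπ hγ, sum_eq_sum_slices hX fun s => γ s * transmitCost v s]
  congr 1
  refine Finset.sum_congr rfl fun e _ => ?_
  simp_rw [fun x => hv.transmitCost_eq x 0 e, ← mul_assoc]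
  rw [← Finset.sum_mul]
  congr 1
  have h : HasSum (fun x => π (x, e) * γ (x, e)) (m e - n e) := by
    have h := (hm e).sub (hn e)
    simp only [silentPart_apply] at h
    refine (congrArg (fun F => HasSum F (m e - n e)) (funext fun x => ?_)).mp h
    ring
  exact (hasSum_sum_of_ne_finset_zero fun x hx => by rw [hX x hx e, zero_mul]).unique h

/-- Match the silent mass of `γ'` at every level, but place it centrally: transmission terms agree
and the silent part improves. Allowing `π'` to differ from `π` serves the Bellman step; `π' = π`
serves the theorem. -/
theorem IsRegular.exists_threshold_cost_le {v : M.Weight → ℝ} (hv : IsRegular v) {a : ℤ}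
    {π π' : M.Weight} (hπ : ∀ s, 0 ≤ π s) (hπ' : ∀ s, 0 ≤ π' s)
    (hasu : ∀ e, IsASU (fun x => π (x, e)) a)
    (hmaj : ∀ e, CentreMajorizes a (fun x => π (x, e)) fun x => π' (x, e))
    {γ' : M.State → ℝ} (hγ' : IsPrescription γ') :
    ∃ γ : M.State → ℝ, IsPrescription γ ∧ M.cost v π γ ≤ M.cost v π' γ' ∧
      ∀ e, e ≠ 0 → IsThreshold (fun x => γ (x, e)) a := by
  choose m hm hm' using fun e => (hmaj e).mass
  obtain ⟨X, hX⟩ := exists_cover (silentPart π' γ')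
  set n : Fin (M.B + 1) → ℝ := fun e => ∑ x ∈ X, silentPart π' γ' (x, e) with hndef
  have hn : ∀ e, HasSum (fun x => silentPart π' γ' (x, e)) (n e) := hasSum_slice hX
  have hle : ∀ s, silentPart π' γ' s ≤ π' s := fun s =>
    mul_le_of_le_one_right (hπ' s) (by linarith [(hγ'.1 s).1])
  have hn0 : ∀ e, 0 ≤ n e := fun e => Finset.sum_nonneg fun x _ => silentPart_nonneg hπ' hγ' _
  have hnm : ∀ e, n e ≤ m e := fun e => hasSum_le (fun x => hle (x, e)) (hn e) (hm' e)
  have hex : ∀ e, ∃ g : ℤ → ℝ, (∀ x, 0 ≤ g x ∧ g x ≤ 1) ∧ (e ≠ 0 → IsThreshold g a) ∧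
      (e = 0 → ∀ x, g x = 0) ∧ IsASU (fun x => π (x, e) * (1 - g x)) a ∧
      HasSum (fun x => π (x, e) * (1 - g x)) (n e) ∧
      CentreMajorizes a (fun x => π (x, e) * (1 - g x)) fun x => silentPart π' γ' (x, e) := by
    intro e
    by_cases he : e = 0
    -- Without energy everything is silent, so the silent slice is the whole slice and its
    -- majorization is the given one.
    · subst he
      have h0 : (fun x => silentPart π' γ' (x, 0)) = fun x => π' (x, 0) := by
        funext x
        simp [hγ'.2 x]
      have h1 : n 0 = m 0 := (hn 0).unique (h0 ▸ hm' 0)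
      refine ⟨fun _ => 0, fun _ => ⟨le_rfl, zero_le_one⟩, fun h => absurd rfl h, fun _ _ => rfl, ?_⟩
      simp only [sub_zero, mul_one]
      rw [h0, h1]
      exact ⟨hasu 0, hm 0, hmaj 0⟩
    · obtain ⟨g, hg, hthr, hgasu, hgsum, hgpart⟩ := exists_threshold (hasu e) (fun x => hπ _)
        (finite_support_slice π e) (hm e) (hn0 e) (hnm e)
      refine ⟨g, hg, fun _ => hthr, fun h => absurd h he, hgasu, hgsum, fun D => ?_,
        n e, hgsum, hn e⟩
      -- The central silent part has partial sums `min` of those of `π` and the silent mass; a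
      -- silent set under `γ'` obeys both bounds.
      rw [hgpart]
      exact le_min ((Finset.sum_le_sum fun x _ => hle (x, e)).trans ((hmaj e).sum_le D))
        (sum_le_hasSum D (fun x _ => silentPart_nonneg hπ' hγ' _) (hn e))
  choose g hg hthr hzero hgasu hgsum hgmaj using hex
  have hγ : IsPrescription (M := M) fun s => g s.2 s.1 :=
    ⟨fun s => hg _ _, fun x => hzero 0 rfl x⟩
  refine ⟨fun s => g s.2 s.1, hγ, ?_, hthr⟩
  rw [hv.cost_eq_of_hasSum hπ hγ hm hgsum, hv.cost_eq_of_hasSum hπ' hγ' hm' hn]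
  exact add_le_add le_rfl (hv.mono a _ _ (silentPart_nonneg hπ hγ) (silentPart_nonneg hπ' hγ')
    hgasu hgmaj)

end Rearrangement

/-- The Bellman step. Superadditivity holds because one prescription for `π + π'` is admissible for
both summands; monotonicity is the exchange argument. -/
theorem IsRegular.iInf_cost {v : M.Weight → ℝ} (hv : IsRegular v) :
    IsRegular fun π => ⨅ γ : {γ : M.State → ℝ // IsPrescription γ}, M.cost v π γ where
  map_smul l hl π hπ := by
    rw [Real.mul_iInf_of_nonneg hl]
    congr 1
    funext γ
    have hlπ : ∀ s, 0 ≤ (l • π) s := fun s => mul_nonneg hl (hπ s)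
    rw [hv.cost_eq hlπ γ.2, hv.cost_eq hπ γ.2, silentPart_smul,
      hv.map_smul l hl _ (silentPart_nonneg hπ γ.2), Finsupp.sum_smul_index (by simp), mul_add,
      Finsupp.mul_sum]
    simp only [mul_assoc]
  superadditive π π' hπ hπ' := by
    refine le_ciInf fun γ => ?_
    have hadd : ∀ s, 0 ≤ (π + π') s := fun s => add_nonneg (hπ s) (hπ' s)
    have h1 := ciInf_le (hv.bddBelow_cost hπ) γ
    have h2 := ciInf_le (hv.bddBelow_cost hπ') γ
    have h3 := hv.superadditive _ _ (silentPart_nonneg hπ γ.2) (silentPart_nonneg hπ' γ.2)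
    rw [hv.cost_eq hπ γ.2] at h1
    rw [hv.cost_eq hπ' γ.2] at h2
    rw [hv.cost_eq hadd γ.2, silentPart_add,
      Finsupp.sum_add_index' (by simp) (by intros; ring)]
    linarith
  lower_bound := by
    obtain ⟨K, hK, h⟩ := hv.exists_cost_lower_bound
    exact ⟨K, hK, fun π hπ => le_ciInf fun γ => h π hπ γ γ.2⟩
  mono a π π' hπ hπ' h1 h2 := by
    refine le_ciInf fun γ' => ?_
    obtain ⟨γ, hγ, hle, _⟩ := hv.exists_threshold_cost_le hπ hπ' h1 h2 γ'.2
    exact (ciInf_le (hv.bddBelow_cost hπ) ⟨γ, hγ⟩).trans hle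

theorem isRegular_valueToGo (k : ℕ) : IsRegular (M.valueToGo k) := by
  induction k with
  | zero => exact IsRegular.zero
  | succ k ih => exact (isRegular_minDistortion.add (ih.comp_predict _)).iInf_cost

theorem isRegular_V (t : ℕ) : IsRegular (M.V t) :=
  isRegular_minDistortion.add ((isRegular_valueToGo _).comp_predict t)

/-! ### Existence of a minimizer -/

section Minimizer

theorem cost_congr (v : M.Weight → ℝ) {π : M.Weight} {γ γ' : M.State → ℝ}
    (h : ∀ s ∈ π.support, γ s = γ' s) : M.cost v π γ = M.cost v π γ' := by
  have h1 : M.silenceProb π γ = M.silenceProb π γ' :=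
    Finsupp.sum_congr fun s hs => by rw [h s hs]
  have h2 : M.update π γ none = M.update π γ' none := by
    ext s
    change π s * (1 - γ s) / M.silenceProb π γ = π s * (1 - γ' s) / M.silenceProb π γ'
    rw [h1]
    by_cases hs : s ∈ π.support
    · rw [h s hs]
    · rw [Finsupp.notMem_support_iff.1 hs, zero_mul, zero_mul]
  refine Finsupp.sum_congr fun s hs => ?_
  rw [h s hs, h2]
  rfl

theorem IsRegular.cost_concave {v : M.Weight → ℝ} (hv : IsRegular v) {π : M.Weight}
    (hπ : ∀ s, 0 ≤ π s) {γ γ₀ γ₁ : M.State → ℝ} (hγ : IsPrescription γ) (h₀ : IsPrescription γ₀)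
    (h₁ : IsPrescription γ₁) {q : ℝ} (hq0 : 0 ≤ q) (hq1 : q ≤ 1)
    (h : ∀ s, γ s = (1 - q) * γ₀ s + q * γ₁ s) :
    (1 - q) * M.cost v π γ₀ + q * M.cost v π γ₁ ≤ M.cost v π γ := by
  have hq1' : 0 ≤ 1 - q := by linarith
  have hsil : silentPart π γ = (1 - q) • silentPart π γ₀ + q • silentPart π γ₁ := by
    ext s
    simp only [silentPart_apply, Finsupp.add_apply, Finsupp.smul_apply, smul_eq_mul, h]
    ring
  have hlin : (π.sum fun s p => p * (γ s * transmitCost v s)) =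
      (1 - q) * (π.sum fun s p => p * (γ₀ s * transmitCost v s)) +
        q * π.sum fun s p => p * (γ₁ s * transmitCost v s) := by
    rw [Finsupp.mul_sum, Finsupp.mul_sum, ← Finsupp.sum_add]
    exact Finsupp.sum_congr fun s _ => by rw [h]; ring
  have hsup := hv.superadditive ((1 - q) • silentPart π γ₀) (q • silentPart π γ₁)
    (fun s => mul_nonneg hq1' (silentPart_nonneg hπ h₀ s))
    (fun s => mul_nonneg hq0 (silentPart_nonneg hπ h₁ s))
  rw [hv.map_smul _ hq1' _ (silentPart_nonneg hπ h₀),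
    hv.map_smul _ hq0 _ (silentPart_nonneg hπ h₁)] at hsup
  rw [hv.cost_eq hπ hγ, hv.cost_eq hπ h₀, hv.cost_eq hπ h₁, hsil, hlin]
  linarith

theorem IsPrescription.update {γ : M.State → ℝ} (hγ : IsPrescription γ) [DecidableEq M.State]
    {s : M.State} (hs : s.2 ≠ 0) {q : ℝ} (hq0 : 0 ≤ q) (hq1 : q ≤ 1) :
    IsPrescription (Function.update γ s q) := by
  refine ⟨fun s' => ?_, fun x => ?_⟩
  · by_cases h : s' = s
    · subst h
      simp [hq0, hq1]
    · rw [Function.update_of_ne h]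
      exact hγ.1 s'
  · rw [Function.update_of_ne (fun h => hs (by rw [← h]))]
    exact hγ.2 x

/-- Concavity in one coordinate of the prescription puts a minimum over that coordinate at 0 or 1;
at zero energy the value is already 0. -/
theorem IsRegular.exists_deterministic_cost_le {v : M.Weight → ℝ} (hv : IsRegular v)
    {π : M.Weight} (hπ : ∀ s, 0 ≤ π s) {γ : M.State → ℝ} (hγ : IsPrescription γ)
    (S : Finset M.State) :
    ∃ γ', IsPrescription γ' ∧ (∀ s ∈ S, γ' s = 0 ∨ γ' s = 1) ∧ M.cost v π γ' ≤ M.cost v π γ := by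
  classical
  induction S using Finset.induction_on with
  | empty => exact ⟨γ, hγ, by simp, le_rfl⟩
  | insert s S _ ih =>
    obtain ⟨γ', hγ', h01, hle⟩ := ih
    by_cases hs : s.2 = 0
    · refine ⟨γ', hγ', fun s' hs' => ?_, hle⟩
      rcases Finset.mem_insert.1 hs' with rfl | h
      · left
        rw [show s' = (s'.1, 0) from Prod.ext rfl hs]
        exact hγ'.2 _
      · exact h01 s' h
    have h₀ := hγ'.update hs le_rfl zero_le_one
    have h₁ := hγ'.update hs zero_le_one le_rfl
    have hconc := hv.cost_concave hπ hγ' h₀ h₁ (hγ'.1 s).1 (hγ'.1 s).2 fun s' => by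
      by_cases h : s' = s
      · subst h; simp
      · rw [Function.update_of_ne h, Function.update_of_ne h]; ring
    have hbin : ∀ p : ℝ, (p = 0 ∨ p = 1) → ∀ s' ∈ insert s S,
        Function.update γ' s p s' = 0 ∨ Function.update γ' s p s' = 1 := by
      intro p hp s' hs'
      by_cases h : s' = s
      · subst h; simpa using hp
      · rw [Function.update_of_ne h]
        exact h01 s' (Finset.mem_of_mem_insert_of_ne hs' h)
    rcases le_total (M.cost v π (Function.update γ' s 0)) (M.cost v π (Function.update γ' s 1))
      with hc | hc
    · refine ⟨_, h₀, hbin 0 (Or.inl rfl), ?_⟩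
      have := mul_le_mul_of_nonneg_left hc (hγ'.1 s).1
      linarith
    · refine ⟨_, h₁, hbin 1 (Or.inr rfl), ?_⟩
      have := mul_le_mul_of_nonneg_left hc (sub_nonneg.2 (hγ'.1 s).2)
      linarith

/-- Only values on the finite support matter, so the deterministic competitors reduce to finitely
many sets of transmitting states. -/
theorem IsRegular.exists_min_cost {v : M.Weight → ℝ} (hv : IsRegular v) {π : M.Weight}
    (hπ : ∀ s, 0 ≤ π s) :
    ∃ γ, IsPrescription γ ∧ ∀ γ', IsPrescription γ' → M.cost v π γ ≤ M.cost v π γ' := by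
  classical
  set ind : Finset M.State → M.State → ℝ := fun T s => if s ∈ T then 1 else 0 with hind
  set 𝒯 := π.support.powerset.filter fun T => ∀ s ∈ T, s.2 ≠ 0 with h𝒯
  obtain ⟨T, hT, hmin⟩ := Finset.exists_min_image 𝒯 (fun T => M.cost v π (ind T))
    ⟨∅, by simp [h𝒯]⟩
  refine ⟨ind T, ⟨fun s => ?_, fun x => if_neg fun h => ?_⟩, fun γ hγ => ?_⟩
  · simp only [hind]
    split_ifs <;> norm_num
  · exact (Finset.mem_filter.1 hT).2 _ h rfl
  · obtain ⟨γ', hγ', h01, hle⟩ := hv.exists_deterministic_cost_le hπ hγ π.support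
    refine le_trans ?_ hle
    have hcongr : M.cost v π γ' = M.cost v π (ind (π.support.filter fun s => γ' s = 1)) := by
      refine cost_congr v fun s hs => ?_
      simp only [hind, Finset.mem_filter, hs, true_and]
      rcases h01 s hs with h | h <;> simp [h]
    rw [hcongr]
    refine hmin _ (Finset.mem_filter.2 ⟨by simp, fun s hs hs0 => ?_⟩)
    have h1 := (Finset.mem_filter.1 hs).2
    rw [show s = (s.1, 0) from Prod.ext rfl hs0, hγ'.2] at h1
    exact zero_ne_one h1

end Minimizer

end RemoteEstimation

theorem mainTheorem2 (M : RemoteEstimation) (t : ℕ) (ht : 1 ≤ t) (htT : t ≤ M.T)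
    (π : M.Weight) (hπ : RemoteEstimation.IsBelief π)
    (a : ℤ) (hasu : ∀ e : Fin (M.B + 1), IsASU (fun x => π (x, e)) a) :
    ∃ γ : M.State → ℝ,
      RemoteEstimation.IsPrescription γ ∧
      M.cost (M.V t) π γ = M.W t π ∧
      (∀ γ' : M.State → ℝ, RemoteEstimation.IsPrescription γ' →
        M.cost (M.V t) π γ ≤ M.cost (M.V t) π γ') ∧
      ∀ e : Fin (M.B + 1), e ≠ 0 → IsThreshold (fun x => γ (x, e)) a := by
  have hv := RemoteEstimation.isRegular_V (M := M) t
  obtain ⟨X, hX⟩ := RemoteEstimation.exists_cover π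
  obtain ⟨γ₀, hγ₀, hmin⟩ := hv.exists_min_cost hπ.1
  obtain ⟨γ, hγ, hle, hthr⟩ := hv.exists_threshold_cost_le hπ.1 hπ.1 hasu
    (fun e => (hasu e).centreMajorizes_self (RemoteEstimation.hasSum_slice hX e).summable) hγ₀
  have hγmin : ∀ γ' : M.State → ℝ, RemoteEstimation.IsPrescription γ' →
      M.cost (M.V t) π γ ≤ M.cost (M.V t) π γ' := fun γ' hγ' => hle.trans (hmin γ' hγ')
  refine ⟨γ, hγ, ?_, hγmin, hthr⟩
  rw [M.W_eq htT]
  exact le_antisymm (le_ciInf fun γ' => hγmin γ' γ'.2) (ciInf_le (hv.bddBelow_cost hπ.1) ⟨γ, hγ⟩)
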